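/- **Theorem.** Let $\gamma(x) = (2\pi)^{-n/2} e^{-|x|^2/2}$ be the standard Gaussian on $\mathbf{R}^n$ and $\gamma_\varepsilon(x) = \varepsilon^{-n}\gamma(x/\varepsilon)$ for $\varepsilon>0$. For a measurable set $E\subset\mathbf{R}^n$ let $$P(E) = \sup\Big\{\int_E \operatorname{div}\phi\,dx \;:\; \phi\in C^1_c(\mathbf{R}^n;\mathbf{R}^n),\ |\phi|\le 1\Big\}\in[0,\infty]$$ denote its perimeter. For a bounded or integrable function $u$ let $$\|u\|_{H^{1/2}}^2 = \int |\xi|\,|\widehat{u}(\xi)|^2\,d\xi\in[0,\infty],$$ where, if $u$ is not integrable, $\widehat u$ is the Fourier transform of the tempered distribution $u$, restricted to $\mathbf{R}^n\setminus\{0\}$, and the norm is $\infty$ if this restriction is not a locally integrable function. Let $E\subset\mathbf{R}^n$ be a (Lebesgue) measurable set. If $P(E)=\infty$, then $$\limsup_{\varepsilon\to 0^+}\frac{1}{|\log\varepsilon|}\,\|\gamma_\varepsilon * \mathbf{1}_E\|_{H^{1/2}}^2 = \infty .$$ Consequently, finiteness of the limsup characterizes sets of finite perimeter: if moreover $E$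 or its complement has finite measure, then $$\limsup_{\varepsilon\to 0^+}\frac{1}{|\log\varepsilon|}\,\|\gamma_\varepsilon * \mathbf{1}_E\|_{H^{1/2}}^2 < \infty \iff P(E)<\infty .$$ -/

import Mathlib

open MeasureTheory Filter Topology Set
open scoped ENNReal FourierTransform SchwartzMap Convolution ContDiff

noncomputable section

namespace GaussPerimeter

/-- The divergence of a vector field on `ℝⁿ`. -/
def divergence {n : ℕ} (φ : EuclideanSpace ℝ (Fin n) → EuclideanSpace ℝ (Fin n))
    (x : EuclideanSpace ℝ (Fin n)) : ℝ :=
  ∑ i : Fin n, (fderiv ℝ φ x (EuclideanSpace.single i 1)) i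

/-- The (De Giorgi) perimeter of a set `E ⊆ ℝⁿ`:
the supremum of `∫_E div φ` over all `φ ∈ C¹_c(ℝⁿ; ℝⁿ)` with `|φ| ≤ 1` everywhere. -/
def perimeter {n : ℕ} (E : Set (EuclideanSpace ℝ (Fin n))) : ℝ≥0∞ :=
  ⨆ (φ : EuclideanSpace ℝ (Fin n) → EuclideanSpace ℝ (Fin n))
    (_ : ContDiff ℝ 1 φ ∧ HasCompactSupport φ ∧ ∀ x, ‖φ x‖ ≤ 1),
    ENNReal.ofReal (∫ x in E, divergence φ x)

/-- The standard Gaussian density `γ(x) = (2π)^{-n/2} exp(-|x|²/2)` on `ℝⁿ`. -/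
def gaussian (n : ℕ) (x : EuclideanSpace ℝ (Fin n)) : ℝ :=
  (2 * Real.pi) ^ (-(n : ℝ) / 2) * Real.exp (-‖x‖ ^ 2 / 2)

/-- The scaled Gaussian `γ_ε(x) = ε^{-n} γ(x / ε)`. -/
def scaledGaussian (n : ℕ) (ε : ℝ) (x : EuclideanSpace ℝ (Fin n)) : ℝ :=
  (ε ^ n)⁻¹ * gaussian n (ε⁻¹ • x)

/-- The smoothed indicator function `γ_ε * 1_E`. -/
def smoothedIndicator {n : ℕ} (ε : ℝ) (E : Set (EuclideanSpace ℝ (Fin n))) :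
    EuclideanSpace ℝ (Fin n) → ℝ :=
  scaledGaussian n ε ⋆[ContinuousLinearMap.mul ℝ ℝ, volume] (E.indicator fun _ => (1 : ℝ))

/-- The function `g` is the Fourier transform of `u` away from the origin: `g` is locally
integrable on `ℝⁿ \ {0}`, and the Fourier transform of the tempered distribution `u`, which is
`φ ↦ ∫ u 𝓕φ`, acts on test functions supported in a compact subset of `ℝⁿ \ {0}` as `φ ↦ ∫ g φ`.
Such a `g` is unique almost everywhere on `ℝⁿ \ {0}`. -/
def IsFourierAwayFromZero {n : ℕ} (u g : EuclideanSpace ℝ (Fin n) → ℂ) : Prop :=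
  LocallyIntegrableOn g {0}ᶜ ∧
    ∀ φ : 𝓢(EuclideanSpace ℝ (Fin n), ℂ), HasCompactSupport φ → tsupport φ ⊆ {0}ᶜ →
      ∫ ξ, g ξ * φ ξ = ∫ x, u x * (𝓕 φ) x

/-- The squared homogeneous Sobolev norm `‖u‖²_{H^{1/2}} = ∫ |ξ| |û(ξ)|² dξ ∈ [0, ∞]` of a bounded
or integrable function `u`. It is `∞` if `û` is not a locally integrable function on `ℝⁿ \ {0}`;
the behaviour of `û` at the origin (where the weight `|ξ|` vanishes) is disregarded, so that the
norm also makes sense for functions which do not decay and is unchanged by adding constants. -/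
def hHalfNormSq {n : ℕ} (u : EuclideanSpace ℝ (Fin n) → ℂ) : ℝ≥0∞ :=
  ⨅ (g : EuclideanSpace ℝ (Fin n) → ℂ) (_ : IsFourierAwayFromZero u g),
    ∫⁻ ξ, ‖ξ‖ₑ * ‖g ξ‖ₑ ^ 2

/-- For an integrable function (for instance a Schwartz function) the norm is the
classical expression `∫ |ξ| |û(ξ)|² dξ`. -/
theorem hHalfNormSq_of_integrable {n : ℕ} {u : EuclideanSpace ℝ (Fin n) → ℂ}
    (hu : Integrable u) : hHalfNormSq u = ∫⁻ ξ, ‖ξ‖ₑ * ‖(𝓕 u) ξ‖ₑ ^ 2 := by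
  have hcont : Continuous (𝓕 u) := VectorFourier.fourierIntegral_continuous
    Real.continuous_fourierChar (innerSL ℝ).continuous₂ hu
  have hF : IsFourierAwayFromZero u (𝓕 u) := by
    refine ⟨(hcont.locallyIntegrable).locallyIntegrableOn _, fun φ _ _ => ?_⟩
    have h := VectorFourier.integral_fourierIntegral_smul_eq_flip
      (L := innerₗ (EuclideanSpace ℝ (Fin n))) (μ := volume) (ν := volume)
      Real.continuous_fourierChar (innerSL ℝ).continuous₂ hu φ.integrable
    rw [flip_innerₗ] at h
    simpa [SchwartzMap.fourier_coe, smul_eq_mul] using! h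
  refine le_antisymm (iInf₂_le _ hF) (le_iInf₂ fun g hg => le_of_eq ?_)
  have hae : ∀ᵐ ξ : EuclideanSpace ℝ (Fin n), ξ ∈ ({0}ᶜ : Set (EuclideanSpace ℝ (Fin n))) →
      (𝓕 u - g) ξ = 0 := by
    refine isOpen_compl_singleton.ae_eq_zero_of_integral_contDiff_smul_eq_zero
      (hF.1.sub hg.1) fun χ hχ hc hs => ?_
    have hs' : tsupport (fun x => (χ x : ℂ)) ⊆ tsupport χ :=
      closure_mono fun x hx => by simpa using hx
    have hc' : HasCompactSupport (fun x => (χ x : ℂ)) := hc.of_isClosed_subset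
      (isClosed_tsupport _) hs'
    have hd' : ContDiff ℝ ∞ (fun x => (χ x : ℂ)) := Complex.ofRealCLM.contDiff.comp hχ
    have key : ∀ f : EuclideanSpace ℝ (Fin n) → ℂ, LocallyIntegrableOn f {0}ᶜ →
        Integrable (fun x => χ x • f x) := by
      intro f hf
      have h1 : IntegrableOn f (tsupport χ) :=
        (locallyIntegrableOn_iff isOpen_compl_singleton.isLocallyClosed).1 hf _ hs hc
      have h2 : IntegrableOn (fun x => χ x • f x) (tsupport χ) :=
        h1.continuousOn_smul hχ.continuous.continuousOn hc
      refine (integrableOn_iff_integrable_of_support_subset fun x hx => ?_).1 h2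
      exact subset_tsupport _ fun h0 => hx (by simp [h0])
    have e1 := hF.2 (hc'.toSchwartzMap hd') hc' (hs'.trans hs)
    have e2 := hg.2 (hc'.toSchwartzMap hd') hc' (hs'.trans hs)
    have e3 := e1.trans e2.symm
    simp only [Pi.sub_apply, smul_sub]
    rw [integral_sub (key _ hF.1) (key _ hg.1), sub_eq_zero]
    simpa [mul_comm] using e3
  refine lintegral_congr_ae ?_
  filter_upwards [hae] with ξ hξ
  by_cases h0 : ξ = 0
  · simp [h0]
  · have := hξ h0
    rw [Pi.sub_apply, sub_eq_zero] at this
    rw [this]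

/-- The functional `|log ε|⁻¹ ‖γ_ε * 1_E‖²_{H^{1/2}}`. -/
def energy {n : ℕ} (E : Set (EuclideanSpace ℝ (Fin n))) (ε : ℝ) : ℝ≥0∞ :=
  (ENNReal.ofReal |Real.log ε|)⁻¹ * hHalfNormSq fun x => (smoothedIndicator ε E x : ℂ)

end GaussPerimeter

end

namespace GaussPerimeter

/-! Write f for the indicator of E and g for its Fourier transform away from the origin. Smoothing
multiplies g by a Gaussian, so the norm to be compared with |log ε| is ∫ |ξ| exp(-4π²ε²|ξ|²) |g|².
Since f takes only the values 0 and 1, the L¹ norm of f(·+h) - f equals its squared L² norm, which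
Plancherel relates to ∫ |exp(2πi ξ·h) - 1|² |g|². Finite perimeter means that the L¹ norm is O(|h|).
It is therefore a bound on quadratic averages of g at frequency scale 1/|h|, and |log ε| counts the
dyadic scales up to 1/ε.

Energy controls perimeter: the weights min(2^k, |ξ|²/2^k), summed over k ≤ N, are dominated by a
geometrically weighted sum of the Gaussian weights at scales 2^{-(N+j)}
(`exists_sum_min_two_pow_le`). If the energy is bounded, the first N+1 averages of |g|² against
these weights sum to O(N), so infinitely many of them stay below a fixed bound
(`exists_frequently_lintegral_min_le`). With h = 2^{-k} e_i this bounds the L¹ difference quotients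
along a sequence of scales, and such a sequence suffices to bound ∫_E ∂_i ψ. As f need not be
integrable, the required half of Plancherel, `IsFourierAwayFromZero.lintegral_difference_sq_le`,
needs a proof that the difference f(·+h) - f carries no spectral mass at the origin.

Perimeter controls energy: duality gives ‖f(·+te_i) - f‖₁ ≤ tK (`lintegral_difference_le`), hence a
linear bound in R for ∫ |ξ|² |g|² over the ball of radius R. A dyadic decomposition of the Gaussian
weight (`lintegral_mul_exp_neg_le`) then yields O(|log ε|). -/

theorem contDiff_fourierChar_inner {V : Type*} [NormedAddCommGroup V] [InnerProductSpace ℝ V] (h : V) :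
    ContDiff ℝ ∞ fun ξ : V => (Real.fourierChar (inner ℝ ξ h) : ℂ) := by
  simp only [Real.fourierChar_apply]
  have : ContDiff ℝ ∞ fun ξ : V => 2 * Real.pi * inner ℝ ξ h :=
    contDiff_const.mul (contDiff_id.inner ℝ contDiff_const)
  exact ((Complex.ofRealCLM.contDiff.comp this).mul contDiff_const).cexp

/-! ### Fubini identities for Fourier transforms and convolutions -/

section General

variable {V : Type*} [NormedAddCommGroup V] [InnerProductSpace ℝ V] [FiniteDimensional ℝ V]
  [MeasurableSpace V] [BorelSpace V]

/-- Translating 𝓕 φ amounts to modulating φ, after which the self-adjointness of the Fourier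
integral applies. -/
theorem integral_mul_fourier_add {K φ : V → ℂ} (hK : Integrable K) (hφ : Integrable φ) (z : V) :
    ∫ y, K y * 𝓕 φ (z + y) = 𝓕 (fun ξ => 𝓕 K ξ * φ ξ) z := by
  have hφ' : Integrable fun ξ => Real.fourierChar (-inner ℝ ξ z) • φ ξ :=
    (Real.fourierIntegral_convergent_iff z).2 hφ
  have h := VectorFourier.integral_fourierIntegral_smul_eq_flip
    (L := innerₗ V) (μ := volume) (ν := volume)
    Real.continuous_fourierChar (innerSL ℝ).continuous₂ hK hφ'
  rw [flip_innerₗ] at h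
  calc _ = ∫ y, K y • 𝓕 (fun ξ => Real.fourierChar (-inner ℝ ξ z) • φ ξ) y := by
        refine integral_congr_ae (.of_forall fun y => ?_)
        simp only [smul_eq_mul]
        congr 1
        simp only [Real.fourier_eq]
        refine integral_congr_ae (.of_forall fun ξ => ?_)
        simp only [Circle.smul_def, smul_eq_mul, inner_add_right, neg_add,
          AddChar.map_add_eq_mul, Circle.coe_mul]
        ring
    _ = ∫ ξ, 𝓕 K ξ • (Real.fourierChar (-inner ℝ ξ z) • φ ξ) := h.symm
    _ = _ := by
        rw [Real.fourier_eq]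
        refine integral_congr_ae (.of_forall fun ξ => ?_)
        simp only [Circle.smul_def, smul_eq_mul]
        ring

theorem integrable_mul_comp_add {F K Φ : V → ℂ} {C : ℝ} (hF : AEStronglyMeasurable F)
    (hC : ∀ x, ‖F x‖ ≤ C) (hK : Integrable K) (hΦ : Integrable Φ) :
    Integrable (fun p : V × V => K p.1 * (F p.2 * Φ (p.2 + p.1)))
      ((volume : Measure V).prod volume) := by
  have h1 := (measurePreserving_prod_add (volume : Measure V) volume).integrable_comp_of_integrable
    (hK.mul_prod hΦ)
  have h2 := h1.bdd_mul (f := fun p : V × V => F p.2) (c := C) hF.comp_snd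
    (.of_forall fun p => hC p.2)
  refine h2.congr (.of_forall fun p => ?_)
  simp only [Function.comp, add_comm p.2]
  ring

theorem integral_mul_fourier_fourier_mul {F K φ : V → ℂ} {C : ℝ} (hF : AEStronglyMeasurable F)
    (hC : ∀ x, ‖F x‖ ≤ C) (hK : Integrable K) (hφ : Integrable φ) (hφ' : Integrable (𝓕 φ)) :
    ∫ x, F x * 𝓕 (fun ξ => 𝓕 K ξ * φ ξ) x = ∫ y, K y * ∫ x, F x * 𝓕 φ (x + y) := by
  simp only [← integral_mul_fourier_add hK hφ, ← integral_const_mul]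
  have hint := integrable_mul_comp_add hF hC hK hφ'
  rw [integral_integral_swap (f := fun y x => K y * (F x * 𝓕 φ (x + y))) hint]
  refine integral_congr_ae (.of_forall fun x => integral_congr_ae (.of_forall fun y => ?_))
  simp only
  ring

theorem integral_convolution_mul {F : V → ℝ} {K : V → ℝ} {Φ : V → ℂ} {C : ℝ}
    (hF : AEStronglyMeasurable F) (hC : ∀ x, ‖F x‖ ≤ C) (hK : Integrable K) (hΦ : Integrable Φ) :
    ∫ x, (((K ⋆[ContinuousLinearMap.mul ℝ ℝ, volume] F) x : ℝ) : ℂ) * Φ x =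
      ∫ y, (K y : ℂ) * ∫ x, (F x : ℂ) * Φ (x + y) := by
  have hF' : AEStronglyMeasurable fun x => (F x : ℂ) :=
    Complex.continuous_ofReal.comp_aestronglyMeasurable hF
  have hC' : ∀ x, ‖(F x : ℂ)‖ ≤ C := fun x => by simpa using hC x
  have hint := integrable_mul_comp_add hF' hC' hK.ofReal hΦ
  have hmp : MeasurePreserving (fun p : V × V => (p.1, -p.1 + p.2))
      ((volume : Measure V).prod volume) (volume.prod volume) :=
    measurePreserving_prod_neg_add volume volume
  have hint2 := hmp.integrable_comp_of_integrable hint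
  have e : ∀ y : V, ∫ x, (F x : ℂ) * Φ (x + y) = ∫ x, (F (x - y) : ℂ) * Φ x := fun y => by
    rw [← integral_sub_right_eq_self _ y]
    simp
  simp only [e, ← integral_const_mul]
  rw [integral_integral_swap]
  · refine integral_congr_ae (.of_forall fun x => ?_)
    simp only [convolution, ContinuousLinearMap.mul_apply']
    rw [← integral_complex_ofReal, ← integral_mul_const]
    refine integral_congr_ae (.of_forall fun y => ?_)
    simp only [Complex.ofReal_mul]
    ring
  · refine hint2.congr (.of_forall fun p => ?_)
    simp [Function.comp, Function.uncurry, neg_add_eq_sub]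

end General

variable {n : ℕ}

local notation "𝔼" => EuclideanSpace ℝ (Fin n)

/-! ### The Gaussian multiplier and Fourier transforms away from the origin -/

theorem scaledGaussian_eq {ε : ℝ} (y : 𝔼) :
    scaledGaussian n ε y =
      (ε ^ n)⁻¹ * (2 * Real.pi) ^ (-(n : ℝ) / 2) * Real.exp (-(1 / (2 * ε ^ 2)) * ‖y‖ ^ 2) := by
  rw [scaledGaussian, gaussian, norm_smul, mul_assoc]
  congr 3
  rw [norm_inv, mul_pow, inv_pow, Real.norm_eq_abs, sq_abs]
  ring

theorem integrable_scaledGaussian {ε : ℝ} (hε : 0 < ε) : Integrable (scaledGaussian n ε) := by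
  have h := (GaussianFourier.integrable_cexp_neg_mul_sq_norm_add (V := 𝔼)
    (b := ((1 / (2 * ε ^ 2) : ℝ) : ℂ)) (by simpa only [Complex.ofReal_re] using by positivity) 0 0).norm
  refine (h.const_mul ((ε ^ n)⁻¹ * (2 * Real.pi) ^ (-(n : ℝ) / 2))).congr (.of_forall fun y => ?_)
  simp only [scaledGaussian_eq, Complex.norm_exp]
  congr 2
  simp [← Complex.ofReal_pow, ← Complex.ofReal_mul, ← Complex.ofReal_neg]

theorem fourier_scaledGaussian {ε : ℝ} (hε : 0 < ε) (ξ : 𝔼) :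
    𝓕 (fun y => (scaledGaussian n ε y : ℂ)) ξ =
      (Real.exp (-2 * Real.pi ^ 2 * ε ^ 2 * ‖ξ‖ ^ 2) : ℂ) := by
  have h := fourier_gaussian_innerProductSpace (V := 𝔼)
    (b := ((1 / (2 * ε ^ 2) : ℝ) : ℂ)) (by simpa only [Complex.ofReal_re] using by positivity) ξ
  set c : ℝ := (ε ^ n)⁻¹ * (2 * Real.pi) ^ (-(n : ℝ) / 2) with hc
  have e : (fun y : 𝔼 => (scaledGaussian n ε y : ℂ)) =
      fun y => (c : ℂ) • Complex.exp (-((1 / (2 * ε ^ 2) : ℝ) : ℂ) * ‖y‖ ^ 2) := by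
    ext y
    rw [scaledGaussian_eq]
    simp [hc]
  have e2 : 𝓕 (fun y : 𝔼 => (c : ℂ) • Complex.exp (-((1 / (2 * ε ^ 2) : ℝ) : ℂ) * ‖y‖ ^ 2)) ξ =
      (c : ℂ) * 𝓕 (fun y : 𝔼 => Complex.exp (-((1 / (2 * ε ^ 2) : ℝ) : ℂ) * ‖y‖ ^ 2)) ξ := by
    simp only [Real.fourier_eq, ← integral_const_mul]
    refine integral_congr_ae (.of_forall fun y => ?_)
    simp only [Circle.smul_def, smul_eq_mul]
    ring
  rw [e, e2, h, finrank_euclideanSpace_fin]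
  have hexp : (-(Real.pi : ℂ) ^ 2 * ‖ξ‖ ^ 2 / ((1 / (2 * ε ^ 2) : ℝ) : ℂ)) =
      ((-2 * Real.pi ^ 2 * ε ^ 2 * ‖ξ‖ ^ 2 : ℝ) : ℂ) := by
    have : (ε : ℂ) ≠ 0 := by exact_mod_cast hε.ne'
    push_cast
    field_simp
  rw [hexp, ← Complex.ofReal_exp, ← mul_assoc]
  have hpow : ((Real.pi : ℂ) / ((1 / (2 * ε ^ 2) : ℝ) : ℂ)) ^ ((n : ℂ) / 2) =
      (((2 * Real.pi) ^ ((n : ℝ) / 2) * ε ^ n : ℝ) : ℂ) := by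
    have h1 : ((Real.pi : ℂ) / ((1 / (2 * ε ^ 2) : ℝ) : ℂ)) =
        ((2 * Real.pi * ε ^ 2 : ℝ) : ℂ) := by
      push_cast
      field_simp
    have h2 : ((n : ℂ) / 2) = (((n : ℝ) / 2 : ℝ) : ℂ) := by push_cast; rfl
    rw [h1, h2, ← Complex.ofReal_cpow (by positivity), Real.mul_rpow (by positivity) (by positivity)]
    congr 2
    rw [← Real.rpow_natCast ε 2, ← Real.rpow_mul hε.le, ← Real.rpow_natCast ε n]
    congr 1
    push_cast
    ring
  rw [hpow, ← Complex.ofReal_mul]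
  have : c * ((2 * Real.pi) ^ ((n : ℝ) / 2) * ε ^ n) = 1 := by
    rw [hc, neg_div, Real.rpow_neg (by positivity)]
    have := Real.rpow_pos_of_pos (show 0 < 2 * Real.pi by positivity) ((n : ℝ) / 2)
    field_simp
  rw [this, Complex.ofReal_one, one_mul]

theorem IsFourierAwayFromZero.ae_eq {u g g' : 𝔼 → ℂ} (h : IsFourierAwayFromZero u g)
    (h' : IsFourierAwayFromZero u g') : ∀ᵐ ξ : 𝔼, ξ ≠ 0 → g ξ = g' ξ := by
  have hae : ∀ᵐ ξ : 𝔼, ξ ∈ ({0}ᶜ : Set 𝔼) → (g - g') ξ = 0 := by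
    refine isOpen_compl_singleton.ae_eq_zero_of_integral_contDiff_smul_eq_zero
      (h.1.sub h'.1) fun χ hχ hc hs => ?_
    have hs' : tsupport (fun x => (χ x : ℂ)) ⊆ tsupport χ :=
      closure_mono fun x hx => by simpa using hx
    have hc' : HasCompactSupport (fun x => (χ x : ℂ)) := hc.of_isClosed_subset
      (isClosed_tsupport _) hs'
    have hd' : ContDiff ℝ ∞ (fun x => (χ x : ℂ)) := Complex.ofRealCLM.contDiff.comp hχ
    have key : ∀ f : 𝔼 → ℂ, LocallyIntegrableOn f {0}ᶜ → Integrable (fun x => χ x • f x) := by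
      intro f hf
      have h1 : IntegrableOn f (tsupport χ) :=
        (locallyIntegrableOn_iff isOpen_compl_singleton.isLocallyClosed).1 hf _ hs hc
      have h2 : IntegrableOn (fun x => χ x • f x) (tsupport χ) :=
        h1.continuousOn_smul hχ.continuous.continuousOn hc
      refine (integrableOn_iff_integrable_of_support_subset fun x hx => ?_).1 h2
      exact subset_tsupport _ fun h0 => hx (by simp [h0])
    have e1 := h.2 (hc'.toSchwartzMap hd') hc' (hs'.trans hs)
    have e2 := h'.2 (hc'.toSchwartzMap hd') hc' (hs'.trans hs)
    have e3 := e1.trans e2.symm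
    simp only [Pi.sub_apply, smul_sub]
    rw [integral_sub (key _ h.1) (key _ h'.1), sub_eq_zero]
    simpa [mul_comm] using e3
  filter_upwards [hae] with ξ hξ h0
  simpa [sub_eq_zero] using hξ h0

theorem IsFourierAwayFromZero.hHalfNormSq_eq {u g : 𝔼 → ℂ} (h : IsFourierAwayFromZero u g) :
    hHalfNormSq u = ∫⁻ ξ, ‖ξ‖ₑ * ‖g ξ‖ₑ ^ 2 := by
  refine le_antisymm (iInf₂_le _ h) (le_iInf₂ fun g' hg' => le_of_eq ?_)
  refine lintegral_congr_ae ?_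
  filter_upwards [h.ae_eq hg'] with ξ hξ
  by_cases h0 : ξ = 0
  · simp [h0]
  · rw [hξ h0]

/-- If testing `u` against `𝓕 (m φ)` amounts to testing `v` against `𝓕 φ`, then the Fourier
transform of `v` is `m` times that of `u`. -/
theorem IsFourierAwayFromZero.of_multiplier {u v g m : 𝔼 → ℂ} (hm : ContDiff ℝ ∞ m)
    (hg : IsFourierAwayFromZero u g)
    (huv : ∀ φ : 𝓢(𝔼, ℂ), HasCompactSupport φ →
      ∫ x, v x * 𝓕 (φ : 𝔼 → ℂ) x = ∫ x, u x * 𝓕 (fun ξ => m ξ * φ ξ) x) :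
    IsFourierAwayFromZero v (fun ξ => m ξ * g ξ) := by
  refine ⟨?_, fun φ hφ hs => ?_⟩
  · exact hg.1.continuousOn_mul hm.continuous.continuousOn isOpen_compl_singleton.isLocallyClosed
  · have hc : HasCompactSupport fun ξ => m ξ * φ ξ := hφ.mul_left
    have h := hg.2 (hc.toSchwartzMap (hm.mul φ.smooth')) hc
      ((closure_mono (Function.support_mul_subset_right _ _)).trans hs)
    rw [SchwartzMap.fourier_coe, huv φ hφ]
    rw [SchwartzMap.fourier_coe] at h
    refine Eq.trans ?_ h
    refine integral_congr_ae (.of_forall fun ξ => ?_)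
    change m ξ * g ξ * φ ξ = g ξ * (m ξ * φ ξ)
    ring

/-- The Fourier transform of `scaledGaussian n ε`. -/
noncomputable def gaussianMultiplier (n : ℕ) (ε : ℝ) (ξ : EuclideanSpace ℝ (Fin n)) : ℝ :=
  Real.exp (-2 * Real.pi ^ 2 * ε ^ 2 * ‖ξ‖ ^ 2)

theorem contDiff_gaussianMultiplier (ε : ℝ) : ContDiff ℝ ∞ (gaussianMultiplier n ε) :=
  (contDiff_const.mul (contDiff_norm_sq ℝ)).exp

theorem gaussianMultiplier_pos (ε : ℝ) (ξ : 𝔼) : 0 < gaussianMultiplier n ε ξ := Real.exp_pos _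

theorem norm_indicator_one_le (E : Set 𝔼) (x : 𝔼) : ‖E.indicator (fun _ => (1 : ℝ)) x‖ ≤ 1 := by
  by_cases h : x ∈ E <;> simp [h]

theorem integral_smoothedIndicator_mul_fourier {E : Set 𝔼} (hE : MeasurableSet E) {ε : ℝ}
    (hε : 0 < ε) (φ : 𝓢(𝔼, ℂ)) :
    ∫ x, (smoothedIndicator ε E x : ℂ) * 𝓕 (φ : 𝔼 → ℂ) x =
      ∫ x, ((E.indicator (fun _ => (1 : ℝ)) x : ℝ) : ℂ) *
        𝓕 (fun ξ => (gaussianMultiplier n ε ξ : ℂ) * φ ξ) x := by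
  have hf : Measurable (E.indicator fun _ => (1 : ℝ)) := measurable_const.indicator hE
  have hφ' : Integrable (𝓕 (φ : 𝔼 → ℂ)) := (𝓕 φ).integrable
  unfold smoothedIndicator
  rw [integral_convolution_mul hf.aestronglyMeasurable (norm_indicator_one_le E)
    (integrable_scaledGaussian hε) hφ']
  refine (integral_mul_fourier_fourier_mul (C := 1)
    (Complex.continuous_ofReal.comp_aestronglyMeasurable hf.aestronglyMeasurable)
    (fun x => by simpa using norm_indicator_one_le E x)
    (integrable_scaledGaussian hε).ofReal φ.integrable hφ').symm.trans ?_
  have := fun ξ => fourier_scaledGaussian (n := n) hε ξ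
  refine integral_congr_ae (.of_forall fun x => ?_)
  simp only
  congr 1
  refine congrFun (congrArg _ (funext fun ξ => ?_)) x
  exact congrArg (· * φ ξ) (this ξ)

theorem isFourierAwayFromZero_smoothedIndicator {E : Set 𝔼} (hE : MeasurableSet E) {ε : ℝ}
    (hε : 0 < ε) {g : 𝔼 → ℂ}
    (hg : IsFourierAwayFromZero (fun x => ((E.indicator (fun _ => (1 : ℝ)) x : ℝ) : ℂ)) g) :
    IsFourierAwayFromZero (fun x => (smoothedIndicator ε E x : ℂ))
      (fun ξ => (gaussianMultiplier n ε ξ : ℂ) * g ξ) :=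
  hg.of_multiplier (Complex.ofRealCLM.contDiff.comp (contDiff_gaussianMultiplier ε)) fun φ _ =>
    integral_smoothedIndicator_mul_fourier hE hε φ

/-- Test functions have compact support, so multiplying by the growing inverse of the Gaussian is
harmless. Hence a single ε with finite norm already yields a transform of the indicator itself. -/
theorem isFourierAwayFromZero_indicator {E : Set 𝔼} (hE : MeasurableSet E) {ε : ℝ}
    (hε : 0 < ε) {g : 𝔼 → ℂ}
    (hg : IsFourierAwayFromZero (fun x => (smoothedIndicator ε E x : ℂ)) g) :
    IsFourierAwayFromZero (fun x => ((E.indicator (fun _ => (1 : ℝ)) x : ℝ) : ℂ))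
      (fun ξ => ((gaussianMultiplier n ε ξ)⁻¹ : ℂ) * g ξ) := by
  have hm : ContDiff ℝ ∞ fun ξ : 𝔼 => ((gaussianMultiplier n ε ξ)⁻¹ : ℂ) := by
    have := Complex.ofRealCLM.contDiff.comp ((contDiff_gaussianMultiplier (n := n) ε).inv
      fun ξ => (gaussianMultiplier_pos ε ξ).ne')
    simpa [Function.comp_def] using! this
  refine hg.of_multiplier hm fun φ hφ => ?_
  have hc : HasCompactSupport fun ξ => ((gaussianMultiplier n ε ξ)⁻¹ : ℂ) * φ ξ := hφ.mul_left
  have h := integral_smoothedIndicator_mul_fourier hE hε (hc.toSchwartzMap (hm.mul φ.smooth'))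
  refine Eq.trans ?_ h.symm
  refine integral_congr_ae (.of_forall fun x => ?_)
  simp only
  congr 1
  refine congrFun (congrArg _ (funext fun ξ => ?_)) x
  change φ ξ = (gaussianMultiplier n ε ξ : ℂ) * (((gaussianMultiplier n ε ξ)⁻¹ : ℂ) * φ ξ)
  rw [mul_inv_cancel_left₀]
  exact_mod_cast (gaussianMultiplier_pos ε ξ).ne'

theorem hHalfNormSq_smoothedIndicator {E : Set 𝔼} (hE : MeasurableSet E) {ε : ℝ}
    (hε : 0 < ε) {g : 𝔼 → ℂ}
    (hg : IsFourierAwayFromZero (fun x => ((E.indicator (fun _ => (1 : ℝ)) x : ℝ) : ℂ)) g) :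
    hHalfNormSq (fun x => (smoothedIndicator ε E x : ℂ)) =
      ∫⁻ ξ, ENNReal.ofReal (‖ξ‖ * Real.exp (-4 * Real.pi ^ 2 * ε ^ 2 * ‖ξ‖ ^ 2)) *
        ‖g ξ‖ₑ ^ 2 := by
  rw [(isFourierAwayFromZero_smoothedIndicator hE hε hg).hHalfNormSq_eq]
  refine lintegral_congr fun ξ => ?_
  rw [enorm_mul, mul_pow, ← mul_assoc, ENNReal.ofReal_mul (norm_nonneg _), ofReal_norm]
  congr 2
  rw [← ofReal_norm, ← ENNReal.ofReal_pow (norm_nonneg _), Complex.norm_real,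
    Real.norm_of_nonneg (gaussianMultiplier_pos ε ξ).le, gaussianMultiplier, ← Real.exp_nat_mul]
  congr 2
  push_cast
  ring

/-! ### L² bounds by duality with Schwartz functions -/

theorem eLpNorm_two_sq {α F : Type*} [MeasurableSpace α] [NormedAddCommGroup F] (μ : Measure α)
    (f : α → F) : eLpNorm f 2 μ ^ 2 = ∫⁻ x, ‖f x‖ₑ ^ 2 ∂μ := by
  have := eLpNorm_nnreal_pow_eq_lintegral (μ := μ) (f := f) (p := 2) (by norm_num)
  simpa using! this

theorem sq_lintegral_mul_le {α : Type*} [MeasurableSpace α] {μ : Measure α} {f g : α → ℝ≥0∞}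
    (hf : AEMeasurable f μ) (hg : AEMeasurable g μ) :
    (∫⁻ x, f x * g x ∂μ) ^ 2 ≤ (∫⁻ x, f x ^ 2 ∂μ) * ∫⁻ x, g x ^ 2 ∂μ := by
  have h := ENNReal.lintegral_mul_le_Lp_mul_Lq μ Real.HolderConjugate.two_two hf hg
  calc _ ≤ _ := pow_le_pow_left' h 2
    _ = _ := by
      rw [mul_pow, ← ENNReal.rpow_natCast, ← ENNReal.rpow_natCast, ← ENNReal.rpow_mul,
        ← ENNReal.rpow_mul]
      norm_num

section General

variable {V : Type*} [NormedAddCommGroup V] [InnerProductSpace ℝ V] [FiniteDimensional ℝ V]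
  [MeasurableSpace V] [BorelSpace V]

theorem lintegral_enorm_sq_fourier (ψ : 𝓢(V, ℂ)) :
    ∫⁻ x, ‖𝓕 ψ x‖ₑ ^ 2 = ∫⁻ x, ‖ψ x‖ₑ ^ 2 := by
  have key : ∀ φ : 𝓢(V, ℂ), ∫⁻ x, ‖φ x‖ₑ ^ 2 = ‖φ.toLp 2‖ₑ ^ 2 := fun φ => by
    rw [← eLpNorm_two_sq, Lp.enorm_def, eLpNorm_congr_ae (φ.coeFn_toLp 2 volume)]
  rw [key, key, ← ofReal_norm, ← ofReal_norm, SchwartzMap.norm_fourier_toL2_eq]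

theorem lintegral_enorm_sq_le_of_memLp {v : V → ℂ} (hv : MemLp v 2) {A : ℝ≥0∞}
    (h : ∀ ψ : 𝓢(V, ℂ), ‖∫ x, v x * ψ x‖ₑ ^ 2 ≤ A * ∫⁻ x, ‖ψ x‖ₑ ^ 2) :
    ∫⁻ x, ‖v x‖ₑ ^ 2 ≤ A := by
  rcases eq_or_ne A ⊤ with rfl | hA
  · exact le_top
  -- Conjugation turns the inner product with G into the bilinear pairing ∫ v ψ of the hypothesis.
  have hv' : MemLp (fun x => (starRingEnd ℂ) (v x)) 2 := hv.star
  set G := hv'.toLp with hG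
  have hGae : G =ᵐ[volume] fun x => (starRingEnd ℂ) (v x) := hv'.coeFn_toLp
  have hnorm : ‖G‖ₑ ^ 2 = ∫⁻ x, ‖v x‖ₑ ^ 2 := by
    rw [Lp.enorm_def, eLpNorm_congr_ae hGae, eLpNorm_two_sq]
    simp
  have key : ∀ H : Lp ℂ 2 (volume : Measure V), ‖inner ℂ G H‖ₑ ^ 2 ≤ A * ‖H‖ₑ ^ 2 := by
    refine isClosed_property (SchwartzMap.denseRange_toLpCLM (E := V) (F := ℂ) (p := 2)
      (μ := volume) (by norm_num)) (isClosed_le ?_ ?_) fun ψ => ?_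
    · exact (ENNReal.continuous_pow 2).comp
        (continuous_enorm.comp (continuous_const.inner continuous_id))
    · exact (ENNReal.continuous_const_mul hA).comp ((ENNReal.continuous_pow 2).comp continuous_enorm)
    · rw [SchwartzMap.toLpCLM_apply]
      have e1 : inner ℂ G (ψ.toLp 2) = ∫ x, v x * ψ x := by
        rw [L2.inner_def]
        refine integral_congr_ae ?_
        filter_upwards [hGae, ψ.coeFn_toLp 2 volume] with x h1 h2
        rw [h1, h2]
        simp [mul_comm]
      have e2 : ‖ψ.toLp 2‖ₑ ^ 2 = ∫⁻ x, ‖ψ x‖ₑ ^ 2 := by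
        rw [Lp.enorm_def, eLpNorm_congr_ae (ψ.coeFn_toLp 2 volume), eLpNorm_two_sq]
      rw [e1, e2]
      exact h ψ
  -- Density of Schwartz functions allows testing with G itself: ‖G‖⁴ ≤ A ‖G‖², to be divided by
  -- ‖G‖².
  have hfin := key G
  rw [inner_self_eq_norm_sq_to_K] at hfin
  rw [← hnorm]
  have e3 : ‖((‖G‖ : ℝ) : ℂ) ^ 2‖ₑ = ‖G‖ₑ ^ 2 := by
    rw [enorm_pow, ← ofReal_norm ((‖G‖ : ℝ) : ℂ), Complex.norm_real, norm_norm, ofReal_norm]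
  erw [e3] at hfin
  rcases eq_or_ne G 0 with h0 | h0
  · simp [h0]
  · rw [sq (‖G‖ₑ ^ 2)] at hfin
    exact (ENNReal.mul_le_mul_iff_left (by simpa using h0) (by simp)).1 hfin

/-- A bump function cuts w down to an L² function. The hypothesis survives because the bump can be
moved onto ψ and is at most 1; balls then exhaust the space. -/
theorem lintegral_enorm_sq_le_of_bounded {w : V → ℂ} {C : ℝ} (hw : AEStronglyMeasurable w)
    (hC : ∀ x, ‖w x‖ ≤ C) {A : ℝ≥0∞}
    (h : ∀ ψ : 𝓢(V, ℂ), ‖∫ x, w x * ψ x‖ₑ ^ 2 ≤ A * ∫⁻ x, ‖ψ x‖ₑ ^ 2) :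
    ∫⁻ x, ‖w x‖ₑ ^ 2 ≤ A := by
  have hball : ∀ N : ℕ, ∫⁻ x in Metric.closedBall (0 : V) (N + 1), ‖w x‖ₑ ^ 2 ≤ A := by
    intro N
    let χ : ContDiffBump (0 : V) := ⟨N + 1, N + 2, by positivity, by linarith⟩
    have hχs : HasCompactSupport fun x => (χ x : ℂ) :=
      χ.hasCompactSupport.comp_left (g := fun r : ℝ => (r : ℂ)) Complex.ofReal_zero
    have hχd : ContDiff ℝ ∞ fun x => (χ x : ℂ) := Complex.ofRealCLM.contDiff.comp χ.contDiff
    have hχ1 : ∀ x, ‖(χ x : ℂ)‖ ≤ 1 := fun x => by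
      rw [Complex.norm_real, Real.norm_of_nonneg χ.nonneg]
      exact χ.le_one
    have hv : MemLp (fun x => (χ x : ℂ) * w x) 2 := by
      refine HasCompactSupport.memLp_of_bound (hχs.mul_right)
        (hχd.continuous.aestronglyMeasurable.mul hw) C (.of_forall fun x => ?_)
      rw [norm_mul]
      exact (mul_le_of_le_one_left (norm_nonneg _) (hχ1 x)).trans (hC x)
    refine le_trans ?_ (lintegral_enorm_sq_le_of_memLp hv (A := A) fun ψ => ?_)
    · refine le_trans (le_of_eq ?_) (setLIntegral_le_lintegral (Metric.closedBall (0 : V) (N + 1)) _)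
      refine setLIntegral_congr_fun Metric.isClosed_closedBall.measurableSet fun x hx => ?_
      simp [χ.one_of_mem_closedBall hx]
    · have hc : HasCompactSupport fun x => (χ x : ℂ) * ψ x := hχs.mul_right
      have := h (hc.toSchwartzMap (hχd.mul ψ.smooth'))
      refine le_trans (le_of_eq ?_) (this.trans ?_)
      · congr 3
        ext x
        change _ = w x * ((χ x : ℂ) * ψ x)
        ring
      · gcongr with x
        change ‖(χ x : ℂ) * ψ x‖ₑ ≤ _
        rw [enorm_mul]
        refine mul_le_of_le_one_left (by positivity) ?_
        simpa [← ofReal_norm] using hχ1 x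
  have hU : (⋃ N : ℕ, Metric.closedBall (0 : V) (N + 1)) = univ := by
    refine eq_univ_of_forall fun x => mem_iUnion.2 ?_
    obtain ⟨N, hN⟩ := exists_nat_ge ‖x‖
    exact ⟨N, by simpa using hN.trans (by linarith)⟩
  have hdir : Monotone fun N : ℕ => Metric.closedBall (0 : V) ((N : ℝ) + 1) :=
    fun a b hab => Metric.closedBall_subset_closedBall (by gcongr)
  rw [← setLIntegral_univ, ← hU, setLIntegral_iUnion_of_directed _ hdir.directed_le]
  exact iSup_le hball

/-! ### Translations, dilations and their limits -/

theorem tendsto_integral_norm_comp_add_sub (ψ : 𝓢(V, ℂ)) :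
    Tendsto (fun t : V => ∫ x, ‖ψ (x + t) - ψ x‖) (𝓝 0) (𝓝 0) := by
  set k := Module.finrank ℝ V + 1
  obtain ⟨D, hD⟩ : ∃ D : ℝ, ∀ x, (1 + ‖x‖) ^ k * ‖ψ x‖ ≤ D := ⟨_, fun x => by
    simpa using SchwartzMap.one_add_le_sup_seminorm_apply (𝕜 := ℝ) (m := (k, 0)) (k := k) (n := 0)
      le_rfl le_rfl ψ x⟩
  -- The exponent k exceeds the dimension, so the majorant is integrable. The factor 2^k pays for a
  -- shift with ‖t‖ < 1, where 1 + ‖x‖ ≤ 2 (1 + ‖x + t‖).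
  have hint : Integrable fun x : V => (2 ^ k * D + D) * (1 + ‖x‖) ^ (-(k : ℝ)) :=
    (integrable_one_add_norm (by simp [k])).const_mul _
  have hbd : ∀ x, ‖ψ x‖ ≤ D * (1 + ‖x‖) ^ (-(k : ℝ)) := fun x => by
    rw [Real.rpow_neg (by positivity), Real.rpow_natCast, ← div_eq_mul_inv,
      le_div_iff₀ (by positivity), mul_comm]
    exact hD x
  have hD0 : 0 ≤ D := le_trans (by positivity) (hD 0)
  have : Tendsto (fun t : V => ∫ x, ‖ψ (x + t) - ψ x‖) (𝓝 0) (𝓝 (∫ _ : V, (0 : ℝ))) := by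
    refine tendsto_integral_filter_of_dominated_convergence _
      (.of_forall fun t => ?_) ?_ hint (.of_forall fun x => ?_)
    · exact (((ψ.continuous.comp (continuous_id.add continuous_const)).sub
        ψ.continuous).norm).aestronglyMeasurable
    · filter_upwards [Metric.ball_mem_nhds (0 : V) one_pos] with t ht
      refine .of_forall fun x => ?_
      rw [norm_norm, add_mul]
      refine (norm_sub_le _ _).trans (add_le_add ((hbd _).trans ?_) (hbd x))
      rw [mul_comm (2 ^ k) D, mul_assoc]
      gcongr
      rw [Real.rpow_neg (by positivity), Real.rpow_natCast, Real.rpow_neg (by positivity),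
        Real.rpow_natCast, ← div_eq_mul_inv, inv_le_comm₀ (by positivity) (by positivity), inv_div,
        ← div_pow]
      gcongr
      rw [div_le_iff₀ (by norm_num)]
      have h1 : ‖x‖ ≤ ‖x + t‖ + ‖t‖ := by simpa using norm_sub_le (x + t) t
      have h2 : ‖t‖ < 1 := by simpa using ht
      linarith [norm_nonneg (x + t)]
    · have : Continuous fun t => ‖ψ (x + t) - ψ x‖ :=
        ((ψ.continuous.comp (continuous_const.add continuous_id)).sub continuous_const).norm
      simpa using this.tendsto 0
  simpa using this

theorem norm_integral_mul_comp_add_le {F : V → ℂ} {C : ℝ} (hC : ∀ x, ‖F x‖ ≤ C) {Φ : V → ℂ}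
    (hΦ : Integrable Φ) (y : V) : ‖∫ x, F x * Φ (x + y)‖ ≤ C * ∫ x, ‖Φ x‖ := by
  rw [← integral_add_right_eq_self (fun x => ‖Φ x‖) y, ← integral_const_mul]
  refine norm_integral_le_of_norm_le ((hΦ.comp_add_right y).norm.const_mul C)
    (.of_forall fun x => ?_)
  rw [norm_mul]
  exact mul_le_mul_of_nonneg_right (hC x) (norm_nonneg _)

theorem continuous_integral_mul_comp_add {F : V → ℂ} {C : ℝ} (hF : AEStronglyMeasurable F)
    (hC : ∀ x, ‖F x‖ ≤ C) (ψ : 𝓢(V, ℂ)) : Continuous fun y => ∫ x, F x * ψ (x + y) := by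
  rw [continuous_iff_continuousAt]
  intro y
  have hint : ∀ y, Integrable fun x => F x * ψ (x + y) := fun y =>
    (ψ.integrable.comp_add_right y).bdd_mul hF (.of_forall hC)
  have h0 := ((tendsto_integral_norm_comp_add_sub ψ).const_mul C).comp
    (show Tendsto (fun z => z - y) (𝓝 y) (𝓝 0) by
      simpa using (show Continuous fun z => z - y by fun_prop).tendsto y)
  rw [mul_zero] at h0
  rw [ContinuousAt, tendsto_iff_norm_sub_tendsto_zero]
  refine squeeze_zero (fun _ => norm_nonneg _) (fun z => ?_) h0
  have h1 := norm_integral_mul_comp_add_le (Φ := fun x => ψ (x + (z - y)) - ψ x) hC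
    ((ψ.integrable.comp_add_right (z - y)).sub ψ.integrable) y
  refine le_trans (le_of_eq ?_) h1
  rw [← integral_sub (hint z) (hint y)]
  congr 2
  ext x
  rw [← mul_sub]
  congr 3
  abel

theorem fourier_comp_inv_smul (κ : V → ℂ) {δ : ℝ} (hδ : 0 < δ) (ξ : V) :
    𝓕 (fun y => κ (δ⁻¹ • y)) ξ = (δ ^ Module.finrank ℝ V : ℝ) • 𝓕 κ (δ • ξ) := by
  simp only [Real.fourier_eq]
  have := Measure.integral_comp_inv_smul_of_nonneg (volume : Measure V)
    (fun y => Real.fourierChar (-inner ℝ y (δ • ξ)) • κ y) hδ.le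
  rw [← this]
  refine integral_congr_ae (.of_forall fun y => ?_)
  simp only [inner_smul_left, inner_smul_right]
  congr 2
  simp [hδ.ne']

theorem integral_mul_fourier_dilate_mul {F κ φ : V → ℂ} {C : ℝ} (hF : AEStronglyMeasurable F)
    (hC : ∀ x, ‖F x‖ ≤ C) (hκ : Integrable κ) (hφ : Integrable φ) (hφ' : Integrable (𝓕 φ))
    {δ : ℝ} (hδ : 0 < δ) :
    ∫ x, F x * 𝓕 (fun ξ => 𝓕 κ (δ • ξ) * φ ξ) x = ∫ z, κ z * ∫ x, F x * 𝓕 φ (x + δ • z) := by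
  have hd : (0 : ℝ) < δ ^ Module.finrank ℝ V := by positivity
  have h := integral_mul_fourier_fourier_mul hF hC
    ((integrable_comp_smul_iff volume κ (inv_ne_zero hδ.ne')).2 hκ) hφ hφ'
  have h2 := Measure.integral_comp_inv_smul_of_nonneg (volume : Measure V)
    (fun z => κ z * ∫ x, F x * 𝓕 φ (x + δ • z)) hδ.le
  simp only [smul_inv_smul₀ hδ.ne'] at h2
  rw [h2] at h
  simp only [fourier_comp_inv_smul κ hδ] at h
  have e : ∀ x, 𝓕 (fun ξ => (δ ^ Module.finrank ℝ V : ℝ) • 𝓕 κ (δ • ξ) * φ ξ) x =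
      (δ ^ Module.finrank ℝ V : ℝ) • 𝓕 (fun ξ => 𝓕 κ (δ • ξ) * φ ξ) x := fun x => by
    rw [Real.fourier_eq, Real.fourier_eq, ← integral_smul]
    refine integral_congr_ae (.of_forall fun ξ => ?_)
    simp only [Circle.smul_def, smul_eq_mul, Complex.real_smul]
    ring
  simp only [e, mul_smul_comm, integral_smul] at h
  exact smul_right_injective ℂ hd.ne' h

theorem tendsto_integral_mul_comp_smul {κ p : V → ℂ} {D : ℝ} (hκ : Integrable κ)
    (hp : Continuous p) (hD : ∀ x, ‖p x‖ ≤ D) :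
    Tendsto (fun δ : ℝ => ∫ z, κ z * p (δ • z)) (𝓝[>] 0) (𝓝 ((∫ z, κ z) * p 0)) := by
  rw [← integral_mul_const]
  refine tendsto_integral_filter_of_dominated_convergence (fun z => ‖κ z‖ * D)
    (.of_forall fun δ => ?_) (.of_forall fun δ => .of_forall fun z => ?_)
    (hκ.norm.mul_const D) (.of_forall fun z => ?_)
  · exact hκ.aestronglyMeasurable.mul (hp.comp (continuous_const_smul δ)).aestronglyMeasurable
  · rw [norm_mul]
    exact mul_le_mul_of_nonneg_left (hD _) (norm_nonneg _)
  · have : Continuous fun δ : ℝ => κ z * p (δ • z) := by fun_prop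
    simpa using (this.tendsto 0).mono_left nhdsWithin_le_nhds

/-- A change of variables moves the shift by h from P onto κ, where the dilation shrinks it to δh;
continuity of translation in L¹ finishes. This is what rules out a point mass at frequency zero. -/
theorem tendsto_integral_mul_comp_inv_smul_sub (κ : 𝓢(V, ℂ)) {P : V → ℂ} {D : ℝ}
    (hP : Continuous P) (hD : ∀ x, ‖P x‖ ≤ D) (h : V) :
    Tendsto (fun δ : ℝ => ∫ z, κ z * (P (δ⁻¹ • z - h) - P (δ⁻¹ • z))) (𝓝[>] 0) (𝓝 0) := by
  have h0 : Tendsto (fun δ : ℝ => D * ∫ x, ‖κ (x + δ • h) - κ x‖) (𝓝[>] 0) (𝓝 0) := by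
    have : Tendsto (fun δ : ℝ => δ • h) (𝓝[>] 0) (𝓝 0) := by
      have : Continuous fun δ : ℝ => δ • h := by fun_prop
      simpa using (this.tendsto 0).mono_left nhdsWithin_le_nhds
    simpa using ((tendsto_integral_norm_comp_add_sub κ).comp this).const_mul D
  refine squeeze_zero_norm' ?_ h0
  filter_upwards [self_mem_nhdsWithin] with δ hδ
  have hδ : (0 : ℝ) < δ := hδ
  have hint : ∀ t s : V, Integrable fun z => κ (z + t) * P (δ⁻¹ • z - s) := fun t s =>
    (κ.integrable.comp_add_right t).mul_bdd (c := D)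
      (hP.comp (by fun_prop)).aestronglyMeasurable (.of_forall fun _ => hD _)
  have e : ∫ z, κ z * (P (δ⁻¹ • z - h) - P (δ⁻¹ • z)) =
      ∫ z, (κ (z + δ • h) - κ z) * P (δ⁻¹ • z) := by
    simp only [mul_sub, sub_mul]
    rw [integral_sub (by simpa using hint 0 h) (by simpa using hint 0 0),
      integral_sub (by simpa using hint (δ • h) 0) (by simpa using hint 0 0),
      ← integral_add_right_eq_self (fun z => κ z * P (δ⁻¹ • z - h)) (δ • h)]
    congr 3
    ext z
    rw [smul_add, inv_smul_smul₀ hδ.ne', add_sub_cancel_right]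
  rw [e, ← integral_const_mul]
  refine norm_integral_le_of_norm_le
    (((κ.integrable.comp_add_right _).sub κ.integrable).norm.const_mul D) (.of_forall fun z => ?_)
  rw [norm_mul, mul_comm]
  exact mul_le_mul_of_nonneg_right (hD _) (norm_nonneg _)

end General

/-! ### The Plancherel inequality for differences of a bounded function -/

theorem fourier_fourierChar_sub_one_mul {V : Type*} [NormedAddCommGroup V] [InnerProductSpace ℝ V]
    [FiniteDimensional ℝ V] [MeasurableSpace V] [BorelSpace V] {φ : V → ℂ} (hφ : Integrable φ)
    (h x : V) :
    𝓕 (fun ξ => ((Real.fourierChar (inner ℝ ξ h) : ℂ) - 1) * φ ξ) x = 𝓕 φ (x - h) - 𝓕 φ x := by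
  rw [Real.fourier_eq, Real.fourier_eq, Real.fourier_eq,
    ← integral_sub ((Real.fourierIntegral_convergent_iff _).2 hφ)
      ((Real.fourierIntegral_convergent_iff _).2 hφ)]
  refine integral_congr_ae (.of_forall fun ξ => ?_)
  have e : -inner ℝ ξ (x - h) = -inner ℝ ξ x + inner ℝ ξ h := by
    rw [inner_sub_right]
    ring
  simp only [e, Circle.smul_def, smul_eq_mul, AddChar.map_add_eq_mul, Circle.coe_mul]
  ring

theorem integral_difference_mul {V 𝕜 : Type*} [RCLike 𝕜] [NormedAddCommGroup V]
    [MeasurableSpace V] [BorelSpace V] {μ : Measure V} [μ.IsAddRightInvariant] {f Φ : V → 𝕜} {C : ℝ}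
    (hf : AEStronglyMeasurable f μ) (hC : ∀ x, ‖f x‖ ≤ C) (hΦ : Integrable Φ μ) (h : V) :
    ∫ x, (f (x + h) - f x) * Φ x ∂μ = ∫ x, f x * (Φ (x - h) - Φ x) ∂μ := by
  have h1 : Integrable (fun x => f x * Φ x) μ := hΦ.bdd_mul hf (.of_forall hC)
  have h2 : Integrable (fun x => f x * Φ (x - h)) μ :=
    (hΦ.comp_sub_right h).bdd_mul hf (.of_forall hC)
  have h3 : Integrable (fun x => f (x + h) * Φ x) μ := by
    simpa using h2.comp_add_right h
  simp only [sub_mul, mul_sub]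
  rw [integral_sub h3 h1, integral_sub h2 h1,
    ← integral_add_right_eq_self (fun x => f x * Φ (x - h)) h]
  simp

theorem IsFourierAwayFromZero.difference {f g : 𝔼 → ℂ} {C : ℝ} (hf : AEStronglyMeasurable f)
    (hC : ∀ x, ‖f x‖ ≤ C) (hg : IsFourierAwayFromZero f g) (h : 𝔼) :
    IsFourierAwayFromZero (fun x => f (x + h) - f x)
      (fun ξ => ((Real.fourierChar (inner ℝ ξ h) : ℂ) - 1) * g ξ) := by
  refine hg.of_multiplier ((contDiff_fourierChar_inner h).sub contDiff_const) fun φ _ => ?_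
  rw [integral_difference_mul hf hC (Φ := 𝓕 (φ : 𝔼 → ℂ)) (𝓕 φ).integrable]
  simp only [fourier_fourierChar_sub_one_mul φ.integrable]

theorem IsFourierAwayFromZero.enorm_integral_mul_fourier_sq_le {w g : 𝔼 → ℂ}
    (hg : IsFourierAwayFromZero w g) (φ : 𝓢(𝔼, ℂ)) (hφ : HasCompactSupport φ)
    (hs : tsupport φ ⊆ {0}ᶜ) :
    ‖∫ x, w x * 𝓕 φ x‖ₑ ^ 2 ≤ (∫⁻ ξ, ‖g ξ‖ₑ ^ 2) * ∫⁻ ξ, ‖φ ξ‖ₑ ^ 2 := by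
  rw [← hg.2 φ hφ hs]
  have hgm : AEStronglyMeasurable g (volume.restrict {0}ᶜ) := hg.1.aestronglyMeasurable
  have h0 : φ 0 = 0 := by
    by_contra h
    exact hs (subset_tsupport _ h) rfl
  have e : ∫⁻ ξ, ‖g ξ‖ₑ * ‖φ ξ‖ₑ = ∫⁻ ξ in {0}ᶜ, ‖g ξ‖ₑ * ‖φ ξ‖ₑ := by
    rw [setLIntegral_eq_of_support_subset]
    intro ξ hξ h1
    rw [mem_singleton_iff] at h1
    subst h1
    simp [h0] at hξ
  calc _ ≤ (∫⁻ ξ, ‖g ξ‖ₑ * ‖φ ξ‖ₑ) ^ 2 := by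
        gcongr
        simpa only [enorm_mul] using enorm_integral_le_lintegral_enorm fun ξ => g ξ * φ ξ
    _ ≤ (∫⁻ ξ in {0}ᶜ, ‖g ξ‖ₑ ^ 2) * ∫⁻ ξ in {0}ᶜ, ‖φ ξ‖ₑ ^ 2 := by
        rw [e]
        exact sq_lintegral_mul_le hgm.enorm φ.continuous.enorm.measurable.aemeasurable
    _ ≤ _ := mul_le_mul' (setLIntegral_le_lintegral _ _) (setLIntegral_le_lintegral _ _)

/-- A smooth cutoff equal to one near the origin. -/
noncomputable def cutoff (n : ℕ) : ContDiffBump (0 : EuclideanSpace ℝ (Fin n)) := ⟨1, 2, one_pos, one_lt_two⟩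

theorem contDiff_cutoff_smul (δ : ℝ) : ContDiff ℝ ∞ fun ξ : 𝔼 => (cutoff n (δ • ξ) : ℂ) :=
  Complex.ofRealCLM.contDiff.comp ((cutoff n).contDiff.comp (contDiff_const_smul δ))

theorem hasCompactSupport_cutoff_smul {δ : ℝ} (hδ : δ ≠ 0) :
    HasCompactSupport fun ξ : 𝔼 => (cutoff n (δ • ξ) : ℂ) :=
  ((cutoff n).hasCompactSupport.comp_left (g := fun r : ℝ => (r : ℂ)) Complex.ofReal_zero).comp_smul
    hδ

/-- The localization of a Schwartz function by a dilated cutoff. -/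
noncomputable def cutoffMul (δ : ℝ) (hδ : δ ≠ 0) (φ : 𝓢(𝔼, ℂ)) : 𝓢(𝔼, ℂ) :=
  ((hasCompactSupport_cutoff_smul hδ).mul_right (f' := φ)).toSchwartzMap
    ((contDiff_cutoff_smul δ).mul φ.smooth')

theorem cutoffMul_apply (δ : ℝ) (hδ : δ ≠ 0) (φ : 𝓢(𝔼, ℂ)) (ξ : 𝔼) :
    cutoffMul δ hδ φ ξ = (cutoff n (δ • ξ) : ℂ) * φ ξ := rfl

theorem exists_fourier_eq_cutoff : ∃ κ : 𝓢(𝔼, ℂ), ∀ ξ, 𝓕 (κ : 𝔼 → ℂ) ξ = (cutoff n ξ : ℂ) := by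
  let χ : 𝓢(𝔼, ℂ) := ((cutoff n).hasCompactSupport.comp_left (g := fun r : ℝ => (r : ℂ))
    Complex.ofReal_zero).toSchwartzMap (Complex.ofRealCLM.contDiff.comp (cutoff n).contDiff)
  refine ⟨𝓕⁻ χ, fun ξ => ?_⟩
  rw [← SchwartzMap.fourier_coe, FourierTransform.fourier_fourierInv_eq]
  rfl

theorem integral_mul_fourier_cutoffMul {κ : 𝓢(𝔼, ℂ)}
    (hκ : ∀ ξ, 𝓕 (κ : 𝔼 → ℂ) ξ = (cutoff n ξ : ℂ)) {F : 𝔼 → ℂ} {C : ℝ}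
    (hF : AEStronglyMeasurable F) (hC : ∀ x, ‖F x‖ ≤ C) (φ : 𝓢(𝔼, ℂ)) {δ : ℝ} (hδ : 0 < δ) :
    ∫ x, F x * 𝓕 (cutoffMul δ hδ.ne' φ) x = ∫ z, κ z * ∫ x, F x * 𝓕 φ (x + δ • z) := by
  simp only [SchwartzMap.fourier_coe]
  rw [← integral_mul_fourier_dilate_mul hF hC κ.integrable φ.integrable (𝓕 φ).integrable hδ]
  simp only [hκ]
  rfl

/-- Removes the restriction that φ vanish near the origin. Multiplying φ by a cutoff at frequency
1/δ recovers the full pairing as δ → 0, while the part at frequencies of order δ contributes nothing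
in the limit because w is a difference of translates of a bounded function. -/
theorem IsFourierAwayFromZero.lintegral_difference_sq_le_aux {f g : 𝔼 → ℂ} {C : ℝ}
    (hf : AEStronglyMeasurable f) (hC : ∀ x, ‖f x‖ ≤ C) (h : 𝔼)
    (hg : IsFourierAwayFromZero (fun x => f (x + h) - f x) g) (φ : 𝓢(𝔼, ℂ)) :
    ‖∫ x, (f (x + h) - f x) * 𝓕 φ x‖ₑ ^ 2 ≤ (∫⁻ ξ, ‖g ξ‖ₑ ^ 2) * ∫⁻ ξ, ‖φ ξ‖ₑ ^ 2 := by
  obtain ⟨κ, hκ⟩ := exists_fourier_eq_cutoff (n := n)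
  set w : 𝔼 → ℂ := fun x => f (x + h) - f x with hw
  have hwm : AEStronglyMeasurable w :=
    (hf.comp_measurePreserving (measurePreserving_add_right volume h)).sub hf
  have hwC : ∀ x, ‖w x‖ ≤ C + C := fun x => (norm_sub_le _ _).trans (add_le_add (hC _) (hC _))
  have hκ1 : ∫ z, κ z = 1 := by
    have := hκ 0
    rw [Real.fourier_eq, (cutoff n).one_of_mem_closedBall (by simp [cutoff])] at this
    simpa using this
  set p : 𝔼 → ℂ := fun y => ∫ x, w x * 𝓕 φ (x + y) with hp
  set P : 𝔼 → ℂ := fun y => ∫ x, f x * 𝓕 φ (x + y) with hP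
  have hpP : ∀ y, p y = P (y - h) - P y := fun y => by
    simp only [hp, hP, hw]
    rw [integral_difference_mul hf hC ((𝓕 φ).integrable.comp_add_right y),
      ← integral_sub (((𝓕 φ).integrable.comp_add_right (y - h)).bdd_mul hf (.of_forall hC))
        (((𝓕 φ).integrable.comp_add_right y).bdd_mul hf (.of_forall hC))]
    refine integral_congr_ae (.of_forall fun x => ?_)
    simp only [mul_sub]
    rw [show x - h + y = x + (y - h) by abel]
  have lim1 : Tendsto (fun δ : ℝ => ∫ z, κ z * p (δ • z)) (𝓝[>] 0) (𝓝 (∫ x, w x * 𝓕 φ x)) := by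
    have := tendsto_integral_mul_comp_smul κ.integrable
      (continuous_integral_mul_comp_add hwm hwC (𝓕 φ))
      (norm_integral_mul_comp_add_le hwC (𝓕 φ).integrable)
    rw [hκ1, one_mul] at this
    simpa using this
  have lim2 : Tendsto (fun δ : ℝ => ∫ z, κ z * p (δ⁻¹ • z)) (𝓝[>] 0) (𝓝 0) := by
    simp only [hpP]
    exact tendsto_integral_mul_comp_inv_smul_sub κ
      (continuous_integral_mul_comp_add hf hC (𝓕 φ))
      (norm_integral_mul_comp_add_le hC (𝓕 φ).integrable) h
  have lim := lim1.sub lim2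
  rw [sub_zero] at lim
  refine le_of_tendsto (((ENNReal.continuous_pow 2).comp continuous_enorm).tendsto _ |>.comp lim) ?_
  filter_upwards [Ioo_mem_nhdsGT (show (0 : ℝ) < 1 by norm_num)] with δ hδ
  obtain ⟨hδ, hδ1⟩ := hδ
  have hδ' : 0 < δ⁻¹ := inv_pos.2 hδ
  -- Both cutoffs equal 1 for ‖ξ‖ ≤ δ < 1, so Φ is supported in an annulus and is an admissible test
  -- function.
  set Φ : 𝓢(𝔼, ℂ) := cutoffMul δ hδ.ne' φ - cutoffMul δ⁻¹ hδ'.ne' φ with hΦ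
  have hΦa : ∀ ξ, Φ ξ = ((cutoff n (δ • ξ) - cutoff n (δ⁻¹ • ξ) : ℝ) : ℂ) * φ ξ := fun ξ => by
    rw [hΦ, sub_apply, cutoffMul_apply, cutoffMul_apply]
    push_cast
    ring
  have hΦ0 : ∀ ξ : 𝔼, ‖ξ‖ ≤ δ → Φ ξ = 0 := fun ξ hξ => by
    rw [hΦa, (cutoff n).one_of_mem_closedBall, (cutoff n).one_of_mem_closedBall]
    · simp
    · simp only [cutoff, mem_closedBall_zero_iff, norm_smul, norm_inv, Real.norm_of_nonneg hδ.le]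
      rw [inv_mul_le_iff₀ hδ]
      simpa using hξ
    · simp only [cutoff, mem_closedBall_zero_iff, norm_smul, Real.norm_of_nonneg hδ.le]
      nlinarith [norm_nonneg ξ]
  have hΦs : HasCompactSupport Φ :=
    ((hasCompactSupport_cutoff_smul hδ.ne').mul_right (f' := φ)).sub
      ((hasCompactSupport_cutoff_smul hδ'.ne').mul_right (f' := φ))
  have hΦt : tsupport Φ ⊆ {0}ᶜ := by
    have : tsupport Φ ⊆ {ξ | δ ≤ ‖ξ‖} := closure_minimal (fun ξ hξ => by
      by_contra hlt
      exact hξ (hΦ0 ξ (not_le.1 hlt).le)) (isClosed_le continuous_const continuous_norm)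
    intro ξ hξ h0
    have h1 := this hξ
    rw [mem_singleton_iff] at h0
    subst h0
    simp at h1
    linarith
  have key := hg.enorm_integral_mul_fourier_sq_le Φ hΦs hΦt
  have e : ∫ x, w x * 𝓕 Φ x = (∫ z, κ z * p (δ • z)) - ∫ z, κ z * p (δ⁻¹ • z) := by
    simp only [hp]
    rw [← integral_mul_fourier_cutoffMul hκ hwm hwC φ hδ,
      ← integral_mul_fourier_cutoffMul hκ hwm hwC φ hδ',
      ← integral_sub ((𝓕 (cutoffMul δ hδ.ne' φ)).integrable.bdd_mul hwm (.of_forall hwC))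
        ((𝓕 (cutoffMul δ⁻¹ hδ'.ne' φ)).integrable.bdd_mul hwm (.of_forall hwC)), hΦ,
      sub_eq_add_neg, ← neg_one_smul ℂ, FourierTransform.fourier_add,
      FourierTransform.fourier_smul]
    refine integral_congr_ae (.of_forall fun x => ?_)
    simp
    ring
  simp only [Function.comp]
  rw [← e]
  refine key.trans ?_
  gcongr with ξ
  rw [hΦa, enorm_mul]
  refine mul_le_of_le_one_left (by positivity) ?_
  rw [← ofReal_norm, Complex.norm_real, ENNReal.ofReal_le_one, Real.norm_eq_abs, abs_le]
  constructor <;> linarith [(cutoff n).nonneg (x := δ • ξ), (cutoff n).le_one (x := δ • ξ),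
    (cutoff n).nonneg (x := δ⁻¹ • ξ), (cutoff n).le_one (x := δ⁻¹ • ξ)]

theorem IsFourierAwayFromZero.lintegral_difference_sq_le {f g : 𝔼 → ℂ} {C : ℝ}
    (hf : AEStronglyMeasurable f) (hC : ∀ x, ‖f x‖ ≤ C) (hg : IsFourierAwayFromZero f g) (h : 𝔼) :
    ∫⁻ x, ‖f (x + h) - f x‖ₑ ^ 2 ≤
      ∫⁻ ξ, ‖(Real.fourierChar (inner ℝ ξ h) : ℂ) - 1‖ₑ ^ 2 * ‖g ξ‖ₑ ^ 2 := by
  have hwm : AEStronglyMeasurable fun x => f (x + h) - f x :=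
    (hf.comp_measurePreserving (measurePreserving_add_right volume h)).sub hf
  refine lintegral_enorm_sq_le_of_bounded hwm
    (fun x => (norm_sub_le _ _).trans (add_le_add (hC _) (hC _))) fun ψ => ?_
  have := (hg.difference hf hC h).lintegral_difference_sq_le_aux hf hC h (𝓕⁻ ψ)
  rw [← lintegral_enorm_sq_fourier (𝓕⁻ ψ), FourierTransform.fourier_fourierInv_eq] at this
  simpa only [enorm_mul, mul_pow] using this

/-! ### Dyadic averages from logarithmic growth -/

/-- The terms grow geometrically while 2^k ≤ s and decay geometrically afterwards. The correction
s²/2^N is the remaining tail, and subtracting it closes the induction. -/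
theorem sum_min_two_pow_le_linear (s : ℝ) (N : ℕ) (h0 : 0 ≤ s) (h : s ≤ 2 ^ N) :
    ∑ k ∈ Finset.range (N + 1), min ((2 : ℝ) ^ k) (s ^ 2 / 2 ^ k) ≤ 4 * s - s ^ 2 / 2 ^ N := by
  induction N with
  | zero =>
    simp only [zero_add, Finset.range_one, Finset.sum_singleton, pow_zero, div_one] at h ⊢
    exact (min_le_right _ _).trans (by nlinarith)
  | succ N ih =>
    rw [Finset.sum_range_succ]
    have hlast : min ((2 : ℝ) ^ (N + 1)) (s ^ 2 / 2 ^ (N + 1)) ≤ s ^ 2 / 2 ^ (N + 1) :=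
      min_le_right _ _
    have hhalf : s ^ 2 / 2 ^ (N + 1) = s ^ 2 / 2 ^ N / 2 := by
      rw [pow_succ (2 : ℝ), div_mul_eq_div_div]
    rcases le_total s (2 ^ N) with hs | hs
    · linarith [ih hs]
    · have hgeom : ∑ k ∈ Finset.range (N + 1), min ((2 : ℝ) ^ k) (s ^ 2 / 2 ^ k) ≤
          2 ^ (N + 1) - 1 := by
        refine (Finset.sum_le_sum fun k _ => min_le_left _ _).trans (le_of_eq ?_)
        rw [geom_sum_eq (by norm_num)]
        norm_num
      have h2 : s ^ 2 / 2 ^ (N + 1) ≤ s := by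
        rw [div_le_iff₀ (by positivity)]
        nlinarith
      rw [pow_succ (2 : ℝ)] at hgeom
      linarith

theorem exists_sum_min_two_pow_le (a : ℝ) (ha : 0 ≤ a) (s : ℝ) (h0 : 0 ≤ s) (N : ℕ) :
    ∃ j : ℕ, ∑ k ∈ Finset.range (N + 1), min ((2 : ℝ) ^ k) (s ^ 2 / 2 ^ k) ≤
      4 * Real.exp a * (1 / 2) ^ j * (s * Real.exp (-a * ((1 / 2) ^ (N + j)) ^ 2 * s ^ 2)) := by
  have hex : ∃ j : ℕ, s ≤ 2 ^ (N + j) := by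
    obtain ⟨j, hj⟩ := pow_unbounded_of_one_lt s one_lt_two
    exact ⟨j, hj.le.trans (pow_le_pow_right₀ one_le_two (Nat.le_add_left _ _))⟩
  classical
  -- With the least j such that s ≤ 2^(N+j), the exponential is at least exp(-a). If j > 0,
  -- minimality gives 2^N < 2 · 2^{-j} s, so the geometric sum, below 2^(N+1), is at most 4 · 2^{-j}
  -- s.
  refine ⟨Nat.find hex, ?_⟩
  set j := Nat.find hex with hj
  have hjs : s ≤ 2 ^ (N + j) := Nat.find_spec hex
  have hexp : 1 ≤ Real.exp a * Real.exp (-a * ((1 / 2) ^ (N + j)) ^ 2 * s ^ 2) := by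
    rw [← Real.exp_add, Real.one_le_exp_iff]
    have h1 : (1 / 2 : ℝ) ^ (N + j) * s ≤ 1 := by
      rw [one_div, inv_pow, inv_mul_le_iff₀ (by positivity)]
      simpa using hjs
    have h2 : ((1 / 2 : ℝ) ^ (N + j) * s) ^ 2 ≤ 1 := pow_le_one₀ (by positivity) h1
    nlinarith
  have hle : 4 * (1 / 2) ^ j * s ≤
      4 * Real.exp a * (1 / 2) ^ j * (s * Real.exp (-a * ((1 / 2) ^ (N + j)) ^ 2 * s ^ 2)) := by
    have : 0 ≤ 4 * (1 / 2) ^ j * s := by positivity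
    nlinarith [mul_le_mul_of_nonneg_left hexp this]
  refine le_trans ?_ hle
  rcases Nat.eq_zero_or_pos j with h | h
  · rw [h] at hjs ⊢
    refine (sum_min_two_pow_le_linear s N h0 hjs).trans ?_
    have : 0 ≤ s ^ 2 / 2 ^ N := by positivity
    simp only [pow_zero, mul_one]
    linarith
  · obtain ⟨i, hi⟩ : ∃ i, j = i + 1 := ⟨j - 1, by omega⟩
    have hlt : ¬ s ≤ 2 ^ (N + i) := Nat.find_min hex (by omega)
    rw [not_le] at hlt
    refine (Finset.sum_le_sum fun k _ => min_le_left _ _).trans ?_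
    rw [geom_sum_eq (by norm_num), hi]
    have h3 : (1 / 2 : ℝ) ^ i * 2 ^ (N + i) = 2 ^ N := by
      rw [pow_add, one_div, inv_pow]
      field_simp
    have h4 : (2 : ℝ) ^ N ≤ (1 / 2 : ℝ) ^ i * s := by
      rw [← h3]
      gcongr
    rw [pow_succ (1 / 2 : ℝ), pow_succ (2 : ℝ)]
    norm_num at h4 ⊢
    linarith

/-- The singleton may have positive mass, as {0} does in dimension zero; any function is constant on
it. -/
theorem aestronglyMeasurable_of_compl_singleton {α β : Type*} [MeasurableSpace α]
    [MeasurableSingletonClass α] [TopologicalSpace β] [TopologicalSpace.PseudoMetrizableSpace β]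
    {μ : Measure α} {g : α → β} {a : α} (h : AEStronglyMeasurable g (μ.restrict {a}ᶜ)) :
    AEStronglyMeasurable g μ := by
  have h1 : AEStronglyMeasurable g (μ.restrict {a}) := by
    refine (aestronglyMeasurable_const (b := g a)).congr ?_
    filter_upwards [ae_restrict_mem (measurableSet_singleton a)] with x hx
    rw [mem_singleton_iff.1 hx]
  have := aestronglyMeasurable_union_iff.2 ⟨h1, h⟩
  rwa [union_compl_self, Measure.restrict_univ] at this

/-- If a weighted Gaussian mean of a density grows at most logarithmically, then the scale
invariant dyadic averages of the density are bounded along a sequence of scales. -/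
theorem exists_frequently_lintegral_min_le {V : Type*} [NormedAddCommGroup V] [MeasurableSpace V]
    [OpensMeasurableSpace V] {μ : Measure V} {G : V → ℝ≥0∞} (hG : AEMeasurable G μ) {a : ℝ}
    (ha : 0 ≤ a) {C : ℝ≥0∞} (hC : C ≠ ⊤)
    (h : ∀ᶠ ε in 𝓝[>] (0 : ℝ),
      ∫⁻ ξ, ENNReal.ofReal (‖ξ‖ * Real.exp (-a * ε ^ 2 * ‖ξ‖ ^ 2)) * G ξ ∂μ ≤
        C * ENNReal.ofReal |Real.log ε|) :
    ∃ L : ℝ≥0∞, L ≠ ⊤ ∧ ∃ᶠ k : ℕ in atTop,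
      ∫⁻ ξ, ENNReal.ofReal (min (2 ^ k) (‖ξ‖ ^ 2 / 2 ^ k)) * G ξ ∂μ ≤ L := by
  set B : ℕ → ℝ≥0∞ := fun k => ∫⁻ ξ, ENNReal.ofReal (min (2 ^ k) (‖ξ‖ ^ 2 / 2 ^ k)) * G ξ ∂μ with hB
  -- The factor j + 1 comes from N + j ≤ (N + 1)(j + 1), which splits the logarithm at scale
  -- 2^{-(N+j)}.
  set S : ℝ≥0∞ := ∑' j : ℕ, ENNReal.ofReal (4 * Real.exp a * (1 / 2) ^ j * (j + 1)) with hS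
  have hS_fin : S ≠ ⊤ := by
    refine Summable.tsum_ofReal_ne_top ?_
    have h1 := summable_pow_mul_geometric_of_norm_lt_one 1 (r := (1 / 2 : ℝ)) (by norm_num)
    have h0 := summable_pow_mul_geometric_of_norm_lt_one 0 (r := (1 / 2 : ℝ)) (by norm_num)
    refine ((h1.add h0).mul_left (4 * Real.exp a)).congr fun j => ?_
    ring
  obtain ⟨N₀, hN₀⟩ : ∃ N₀ : ℕ, ∀ m ≥ N₀,
      ∫⁻ ξ, ENNReal.ofReal (‖ξ‖ * Real.exp (-a * ((1 / 2) ^ m) ^ 2 * ‖ξ‖ ^ 2)) * G ξ ∂μ ≤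
        C * ENNReal.ofReal m := by
    have ht : Tendsto (fun m : ℕ => (1 / 2 : ℝ) ^ m) atTop (𝓝[>] 0) :=
      tendsto_nhdsWithin_iff.2 ⟨tendsto_pow_atTop_nhds_zero_of_lt_one (by norm_num) (by norm_num),
        .of_forall fun m => by simp⟩
    obtain ⟨N₀, hN₀⟩ := eventually_atTop.1 (ht.eventually h)
    refine ⟨N₀, fun m hm => (hN₀ m hm).trans ?_⟩
    gcongr
    rw [Real.log_pow, one_div, Real.log_inv, mul_neg, abs_neg, abs_of_nonneg (by positivity)]
    have : Real.log 2 ≤ 1 := (Real.log_le_sub_one_of_pos two_pos).trans (by norm_num)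
    nlinarith [(Nat.cast_nonneg m : (0 : ℝ) ≤ m)]
  have hmeas : ∀ f : ℝ → ℝ, Measurable f → AEMeasurable (fun ξ => ENNReal.ofReal (f ‖ξ‖) * G ξ) μ :=
    fun f hf => (hf.comp measurable_norm).ennreal_ofReal.aemeasurable.mul hG
  set L₀ := C * S with hL₀
  have hL₀_fin : L₀ ≠ ⊤ := ENNReal.mul_ne_top hC hS_fin
  have hsum : ∀ N ≥ N₀, ∑ k ∈ Finset.range (N + 1), B k ≤ (N + 1 : ℕ) * L₀ := by
    intro N hN
    simp only [hB]
    rw [← lintegral_finsetSum' _ fun k _ => hmeas (fun r => min (2 ^ k) (r ^ 2 / 2 ^ k))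
      (by fun_prop)]
    calc _ ≤ ∫⁻ ξ, ∑' j : ℕ, ENNReal.ofReal (4 * Real.exp a * (1 / 2) ^ j) *
          (ENNReal.ofReal (‖ξ‖ * Real.exp (-a * ((1 / 2) ^ (N + j)) ^ 2 * ‖ξ‖ ^ 2)) * G ξ) ∂μ := by
          refine lintegral_mono fun ξ => ?_
          obtain ⟨j, hj⟩ := exists_sum_min_two_pow_le a ha ‖ξ‖ (norm_nonneg _) N
          refine le_trans ?_ (ENNReal.le_tsum j)
          rw [← Finset.sum_mul, ← ENNReal.ofReal_sum_of_nonneg fun k _ => by positivity, ← mul_assoc,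
            ← ENNReal.ofReal_mul (by positivity)]
          gcongr
      _ = ∑' j : ℕ, ENNReal.ofReal (4 * Real.exp a * (1 / 2) ^ j) *
          ∫⁻ ξ, ENNReal.ofReal (‖ξ‖ * Real.exp (-a * ((1 / 2) ^ (N + j)) ^ 2 * ‖ξ‖ ^ 2)) * G ξ
            ∂μ := by
          have hm : ∀ j : ℕ, AEMeasurable (fun ξ =>
              ENNReal.ofReal (‖ξ‖ * Real.exp (-a * ((1 / 2) ^ (N + j)) ^ 2 * ‖ξ‖ ^ 2)) * G ξ) μ :=
            fun j => hmeas (fun r => r * Real.exp (-a * ((1 / 2) ^ (N + j)) ^ 2 * r ^ 2))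
              (by fun_prop)
          rw [lintegral_tsum fun j => (hm j).const_mul _]
          exact tsum_congr fun j => lintegral_const_mul'' _ (hm j)
      _ ≤ ∑' j : ℕ, ((N + 1 : ℕ) * C) * ENNReal.ofReal (4 * Real.exp a * (1 / 2) ^ j * (j + 1)) := by
          refine ENNReal.tsum_le_tsum fun j => ?_
          refine (mul_le_mul_right (hN₀ (N + j) (by omega)) _).trans ?_
          have hle : ENNReal.ofReal ((N + j : ℕ) : ℝ) ≤ (N + 1 : ℕ) * ENNReal.ofReal (j + 1) := by
            rw [← ENNReal.ofReal_natCast (N + 1), ← ENNReal.ofReal_mul (by positivity)]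
            refine ENNReal.ofReal_le_ofReal ?_
            push_cast
            nlinarith [mul_nonneg (Nat.cast_nonneg N : (0 : ℝ) ≤ N) (Nat.cast_nonneg j)]
          rw [ENNReal.ofReal_mul (q := (j : ℝ) + 1) (by positivity)]
          calc _ ≤ ENNReal.ofReal (4 * Real.exp a * (1 / 2) ^ j) *
                (C * ((N + 1 : ℕ) * ENNReal.ofReal (j + 1))) := by gcongr
            _ = _ := by ring
      _ = _ := by
          rw [ENNReal.tsum_mul_left, hL₀, mul_assoc]
  refine ⟨2 * L₀ + 1, by finiteness, ?_⟩
  rw [frequently_atTop]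
  intro k₀
  by_contra hcon
  push Not at hcon
  -- The indices from k₀ to N make up more than half of the N + 1 indices, so if every such average
  -- exceeded 2 L₀ + 1, the sum would exceed (N + 1) L₀.
  set N := 2 * k₀ + N₀ with hN
  have h1 : (N + 1 - k₀ : ℕ) * (2 * L₀ + 1) ≤ ∑ k ∈ Finset.range (N + 1), B k := by
    calc _ = ∑ k ∈ Finset.Ico k₀ (N + 1), (2 * L₀ + 1) := by
            rw [Finset.sum_const, Nat.card_Ico, nsmul_eq_mul]
      _ ≤ ∑ k ∈ Finset.Ico k₀ (N + 1), B k :=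
        Finset.sum_le_sum fun k hk => (hcon k (Finset.mem_Ico.1 hk).1).le
      _ ≤ _ := Finset.sum_le_sum_of_subset fun k hk => by
        simp only [Finset.mem_Ico, Finset.mem_range] at hk ⊢
        omega
  have h2 := h1.trans (hsum N (by omega))
  clear_value L₀
  lift L₀ to NNReal using hL₀_fin
  have h3 : ((N + 1 - k₀ : ℕ) : ℝ) * (2 * L₀ + 1) ≤ ((N + 1 : ℕ) : ℝ) * L₀ := by exact_mod_cast h2
  have h4 : N + 1 - k₀ = k₀ + N₀ + 1 := by omega
  rw [h4, hN] at h3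
  push_cast at h3
  nlinarith [mul_nonneg (Nat.cast_nonneg N₀ : (0 : ℝ) ≤ N₀) L₀.2, L₀.2,
    (Nat.cast_nonneg N₀ : (0 : ℝ) ≤ N₀), (Nat.cast_nonneg k₀ : (0 : ℝ) ≤ k₀),
    show (0 : ℝ) ≤ (L₀ : ℝ) from L₀.2]

/-! ### From L¹ difference quotients to the perimeter -/

theorem norm_fourierChar_sub_one (x : ℝ) :
    ‖(Real.fourierChar x : ℂ) - 1‖ = 2 * |Real.sin (Real.pi * x)| := by
  have := Complex.norm_exp_I_mul_ofReal_sub_one (2 * Real.pi * x)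
  rw [Real.fourierChar_apply, mul_comm, this, norm_mul, Real.norm_eq_abs, Real.norm_eq_abs]
  norm_num
  congr 2
  ring

section Derivative

variable {V : Type*} [NormedAddCommGroup V] [InnerProductSpace ℝ V] [FiniteDimensional ℝ V]
  [MeasurableSpace V] [BorelSpace V]

/-- After reflecting F the pairing is a convolution, whose derivative falls on the smooth factor. -/
theorem hasDerivAt_integral_mul_comp_add_smul {F ψ : V → ℝ} (hF : LocallyIntegrable F)
    (hψ : ContDiff ℝ 1 ψ) (hc : HasCompactSupport ψ) (v : V) (t₀ : ℝ) :
    HasDerivAt (fun t : ℝ => ∫ x, F x * ψ (x + t • v))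
      (∫ x, F x * fderiv ℝ ψ (x + t₀ • v) v) t₀ := by
  have hF' : LocallyIntegrable fun x => F (-x) := by
    have := (locallyIntegrable_map_homeomorph (Homeomorph.neg V) (f := F) (μ := volume)).1
      (by
        have e : Measure.map (Homeomorph.neg V) (volume : Measure V) = volume :=
          (Measure.measurePreserving_neg (volume : Measure V)).map_eq
        rwa [e])
    exact this
  have h := hc.hasFDerivAt_convolution_right (L := ContinuousLinearMap.mul ℝ ℝ) (μ := volume) hF'
    hψ (t₀ • v)
  have h2 := h.comp_hasDerivAt t₀ ((hasDerivAt_id t₀).smul_const v)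
  have e : ∀ Ψ : V → ℝ, ∀ y : V, ((fun x => F (-x)) ⋆[ContinuousLinearMap.mul ℝ ℝ, volume] Ψ) y =
      ∫ x, F x * Ψ (x + y) := fun Ψ y => by
    rw [convolution, ← integral_neg_eq_self]
    simp [add_comm]
  have h3 := convolution_precompR_apply (ContinuousLinearMap.mul ℝ ℝ) hF' (hc.fderiv ℝ)
    (hψ.continuous_fderiv (by norm_num)) (t₀ • v) v
  rw [one_smul] at h2
  rw [h3, e] at h2
  exact h2.congr_of_eventuallyEq (.of_forall fun t => (e ψ (t • v)).symm)

end Derivative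

theorem divergence_eq_sum {φ : 𝔼 → 𝔼} (hφ : Differentiable ℝ φ) (x : 𝔼) :
    divergence φ x = ∑ i, fderiv ℝ (fun y => φ y i) x (EuclideanSpace.single i 1) := by
  refine Finset.sum_congr rfl fun i _ => ?_
  have h : HasFDerivAt (fun y => φ y i) ((EuclideanSpace.proj i : 𝔼 →L[ℝ] ℝ).comp (fderiv ℝ φ x)) x :=
    (EuclideanSpace.proj i : 𝔼 →L[ℝ] ℝ).hasFDerivAt.comp x (hφ x).hasFDerivAt
  rw [h.fderiv]
  rfl

theorem locallyIntegrable_indicator_one {E : Set 𝔼} (hE : MeasurableSet E) :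
    LocallyIntegrable (E.indicator fun _ => (1 : ℝ)) :=
  (locallyIntegrable_const 1).indicator hE

theorem integral_indicator_one_mul {E : Set 𝔼} (hE : MeasurableSet E) (u : 𝔼 → ℝ) :
    ∫ x, E.indicator (fun _ => (1 : ℝ)) x * u x = ∫ x in E, u x := by
  rw [← integral_indicator hE]
  refine integral_congr_ae (.of_forall fun x => ?_)
  by_cases hx : x ∈ E <;> simp [hx]

/-- The difference lies in {-1, 0, 1}. This links the L² theory to the L¹ quantity that perimeter
measures. -/
theorem enorm_indicator_sub_sq (E : Set 𝔼) (x y : 𝔼) :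
    ‖((E.indicator (fun _ => (1 : ℝ)) x : ℝ) : ℂ) - (E.indicator (fun _ => (1 : ℝ)) y : ℝ)‖ₑ ^ 2 =
      ‖E.indicator (fun _ => (1 : ℝ)) x - E.indicator (fun _ => (1 : ℝ)) y‖ₑ := by
  by_cases hx : x ∈ E <;> by_cases hy : y ∈ E <;> simp [hx, hy]

theorem setIntegral_fderiv_le_of_frequently {E : Set 𝔼} (hE : MeasurableSet E) {ψ : 𝔼 → ℝ}
    (hψ : ContDiff ℝ 1 ψ) (hc : HasCompactSupport ψ) (h1 : ∀ x, ‖ψ x‖ ≤ 1) (v : 𝔼) {K : ℝ}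
    (hK : ∃ᶠ k : ℕ in atTop, ∫⁻ x, ‖E.indicator (fun _ => (1 : ℝ)) (x + (1 / 2 : ℝ) ^ k • v) -
      E.indicator (fun _ => (1 : ℝ)) x‖ₑ ≤ ENNReal.ofReal ((1 / 2) ^ k * K)) :
    ‖∫ x in E, fderiv ℝ ψ x v‖ ≤ max K 0 := by
  set f : 𝔼 → ℝ := E.indicator fun _ => (1 : ℝ) with hf
  have hfm : Measurable f := measurable_const.indicator hE
  have hd := hasDerivAt_integral_mul_comp_add_smul (locallyIntegrable_indicator_one hE) hψ hc v 0
  simp only [zero_smul, add_zero] at hd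
  rw [integral_indicator_one_mul hE] at hd
  -- The increments are negative because moving a forward difference from f onto ψ produces a
  -- backward difference.
  have ht : Tendsto (fun k : ℕ => -(1 / 2 : ℝ) ^ k) atTop (𝓝[≠] 0) := by
    refine tendsto_nhdsWithin_iff.2 ⟨?_, .of_forall fun m => by simp⟩
    simpa using (tendsto_pow_atTop_nhds_zero_of_lt_one (r := (1 / 2 : ℝ)) (by norm_num)
      (by norm_num)).neg
  have hlim := (hd.tendsto_slope_zero.comp ht).norm
  refine le_of_tendsto_of_frequently hlim (hK.mono fun k hk => ?_)
  have hψi : Integrable ψ := hψ.continuous.integrable_of_hasCompactSupport hc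
  have hbd : ∀ x, ‖f x‖ ≤ 1 := norm_indicator_one_le E
  set t : ℝ := (1 / 2) ^ k with htdef
  have ht0 : 0 < t := by positivity
  have hint : ∀ y : 𝔼, Integrable fun x => f x * ψ (x + y) := fun y =>
    (hψi.comp_add_right y).bdd_mul hfm.aestronglyMeasurable (.of_forall hbd)
  have e : (∫ x, f x * ψ (x + -t • v)) - ∫ x, f x * ψ x = ∫ x, (f (x + t • v) - f x) * ψ x := by
    rw [integral_difference_mul hfm.aestronglyMeasurable hbd hψi, ← integral_sub (hint _)
      (by simpa using hint 0)]
    simp only [neg_smul, sub_eq_add_neg, mul_add, mul_neg]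
  have hw : ‖∫ x, (f (x + t • v) - f x) * ψ x‖ ≤ t * max K 0 := by
    have hle : ‖∫ x, (f (x + t • v) - f x) * ψ x‖ₑ ≤ ENNReal.ofReal (t * K) := by
      refine (enorm_integral_le_lintegral_enorm _).trans (le_trans (lintegral_mono fun x => ?_) hk)
      rw [enorm_mul]
      refine mul_le_of_le_one_right (by positivity) ?_
      simpa [← ofReal_norm] using h1 x
    rw [← ofReal_norm] at hle
    have := (ENNReal.ofReal_le_ofReal_iff (by positivity)).1 (hle.trans
      (ENNReal.ofReal_le_ofReal (mul_le_mul_of_nonneg_left (le_max_left K 0) ht0.le)))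
    exact this
  simp only [Function.comp, zero_add, zero_smul, add_zero]
  rw [e, norm_smul, norm_inv, norm_neg, Real.norm_of_nonneg ht0.le, inv_mul_le_iff₀ ht0]
  exact hw

/-- The partial derivatives are bounded one at a time, so each coordinate may use its own sequence
of scales. -/
theorem perimeter_lt_top_of_frequently {E : Set 𝔼} (hE : MeasurableSet E) {K : ℝ}
    (hK : ∀ i : Fin n, ∃ᶠ k : ℕ in atTop, ∫⁻ x, ‖E.indicator (fun _ => (1 : ℝ))
      (x + (1 / 2 : ℝ) ^ k • EuclideanSpace.single i (1 : ℝ)) -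
      E.indicator (fun _ => (1 : ℝ)) x‖ₑ ≤ ENNReal.ofReal ((1 / 2) ^ k * K)) :
    perimeter E < ⊤ := by
  refine lt_of_le_of_lt (iSup₂_le fun φ hφ => ?_)
    (ENNReal.ofReal_lt_top (r := ∑ _i : Fin n, max K 0))
  obtain ⟨hφ1, hφc, hφb⟩ := hφ
  refine ENNReal.ofReal_le_ofReal ?_
  have hcomp : ∀ i, ContDiff ℝ 1 fun y => φ y i := fun i =>
    (EuclideanSpace.proj i : 𝔼 →L[ℝ] ℝ).contDiff.comp hφ1
  have hcs : ∀ i, HasCompactSupport fun y => φ y i := fun i =>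
    hφc.comp_left (g := fun z : 𝔼 => z i) rfl
  simp only [divergence_eq_sum (hφ1.differentiable (by norm_num))]
  rw [integral_finsetSum]
  · refine Finset.sum_le_sum fun i _ => (Real.le_norm_self _).trans ?_
    exact setIntegral_fderiv_le_of_frequently hE (hcomp i) (hcs i)
      (fun x => (PiLp.norm_apply_le (φ x) i).trans (hφb x)) _ (hK i)
  · intro i _
    refine Integrable.integrableOn ?_
    exact (((hcomp i).continuous_fderiv (by norm_num)).clm_apply
      continuous_const).integrable_of_hasCompactSupport ((hcs i).fderiv_apply ℝ _)

theorem perimeter_lt_top_of_eventually {E : Set 𝔼} (hE : MeasurableSet E) {C : ℝ≥0∞} (hC : C ≠ ⊤)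
    (h : ∀ᶠ ε in 𝓝[>] (0 : ℝ), hHalfNormSq (fun x => (smoothedIndicator ε E x : ℂ)) ≤
      C * ENNReal.ofReal |Real.log ε|) : perimeter E < ⊤ := by
  obtain ⟨ε, hlt, hε⟩ := (h.and self_mem_nhdsWithin).exists
  have hε : 0 < ε := hε
  have hne : hHalfNormSq (fun x => (smoothedIndicator ε E x : ℂ)) < ⊤ :=
    hlt.trans_lt (ENNReal.mul_lt_top hC.lt_top ENNReal.ofReal_lt_top)
  simp only [hHalfNormSq, iInf_lt_iff] at hne
  obtain ⟨g₀, hg₀, -⟩ := hne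
  have hg := isFourierAwayFromZero_indicator hE hε hg₀
  set g : 𝔼 → ℂ := fun ξ => ((gaussianMultiplier n ε ξ)⁻¹ : ℂ) * g₀ ξ
  have hgm : AEMeasurable (fun ξ => ‖g ξ‖ₑ ^ 2) :=
    (aestronglyMeasurable_of_compl_singleton hg.1.aestronglyMeasurable).enorm.pow_const 2
  obtain ⟨L, hL, hfreq⟩ := exists_frequently_lintegral_min_le hgm (a := 4 * Real.pi ^ 2)
    (by positivity) hC (by
      filter_upwards [h, self_mem_nhdsWithin] with δ hδ hδ0
      rw [hHalfNormSq_smoothedIndicator hE hδ0 hg] at hδ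
      simpa only [neg_mul] using hδ)
  have hfm : AEStronglyMeasurable fun x : 𝔼 => ((E.indicator (fun _ => (1 : ℝ)) x : ℝ) : ℂ) :=
    Complex.continuous_ofReal.comp_aestronglyMeasurable
      (measurable_const.indicator hE).aestronglyMeasurable
  refine perimeter_lt_top_of_frequently hE (K := 4 * Real.pi ^ 2 * L.toReal) fun i =>
    hfreq.mono fun k hk => ?_
  have hdiff := hg.lintegral_difference_sq_le hfm (C := 1)
    (fun x => by simpa using norm_indicator_one_le E x)
    ((1 / 2 : ℝ) ^ k • EuclideanSpace.single i (1 : ℝ))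
  simp only [enorm_indicator_sub_sq] at hdiff
  refine hdiff.trans ?_
  calc _ ≤ ∫⁻ ξ, ENNReal.ofReal (4 * Real.pi ^ 2 * (1 / 2) ^ k) *
        (ENNReal.ofReal (min (2 ^ k) (‖ξ‖ ^ 2 / 2 ^ k)) * ‖g ξ‖ₑ ^ 2) := by
        refine lintegral_mono fun ξ => ?_
        rw [← mul_assoc, ← ENNReal.ofReal_mul (by positivity)]
        gcongr
        rw [← ofReal_norm, ← ENNReal.ofReal_pow (norm_nonneg _), norm_fourierChar_sub_one]
        refine ENNReal.ofReal_le_ofReal ?_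
        rw [mul_pow, sq_abs]
        have hin : inner ℝ ξ ((1 / 2 : ℝ) ^ k • EuclideanSpace.single i (1 : ℝ)) =
            (1 / 2 : ℝ) ^ k * ξ i := by
          rw [inner_smul_right, EuclideanSpace.inner_single_right]
          simp
        rw [hin]
        set t : ℝ := (1 / 2) ^ k with ht
        have h2 : (2 : ℝ) ^ k = t⁻¹ := by rw [ht, one_div, inv_pow, inv_inv]
        have ht0 : 0 < t := by positivity
        rw [h2, div_inv_eq_mul, mul_assoc (4 * Real.pi ^ 2), mul_min_of_nonneg _ _ ht0.le,
          mul_inv_cancel₀ ht0.ne', mul_min_of_nonneg _ _ (by positivity)]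
        -- The two entries of the minimum come from |sin x| ≤ 1 and |sin x| ≤ |x|.
        refine le_min ?_ ?_
        · nlinarith [Real.sin_sq_le_one (Real.pi * (t * ξ i)), Real.pi_gt_three]
        · have hs : Real.sin (Real.pi * (t * ξ i)) ^ 2 ≤ (Real.pi * (t * ξ i)) ^ 2 :=
            sq_le_sq.2 Real.abs_sin_le_abs
          have hx : ξ i ^ 2 ≤ ‖ξ‖ ^ 2 := by
            rw [← sq_abs, ← Real.norm_eq_abs]
            exact pow_le_pow_left₀ (norm_nonneg _) (PiLp.norm_apply_le ξ i) 2
          calc _ ≤ 2 ^ 2 * (Real.pi * (t * ξ i)) ^ 2 := by gcongr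
            _ = 4 * Real.pi ^ 2 * (t * (ξ i ^ 2 * t)) := by ring
            _ ≤ _ := by gcongr
    _ = ENNReal.ofReal (4 * Real.pi ^ 2 * (1 / 2) ^ k) *
        ∫⁻ ξ, ENNReal.ofReal (min (2 ^ k) (‖ξ‖ ^ 2 / 2 ^ k)) * ‖g ξ‖ₑ ^ 2 :=
      lintegral_const_mul' _ _ ENNReal.ofReal_ne_top
    _ ≤ ENNReal.ofReal (4 * Real.pi ^ 2 * (1 / 2) ^ k) * L := by gcongr
    _ = _ := by
      rw [← ENNReal.ofReal_toReal hL, ← ENNReal.ofReal_mul (by positivity),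
        ENNReal.toReal_ofReal ENNReal.toReal_nonneg]
      congr 1
      ring

/-! ### Fourier transforms of integrable functions -/

section Fourier

variable {V : Type*} [NormedAddCommGroup V] [InnerProductSpace ℝ V] [FiniteDimensional ℝ V]
  [MeasurableSpace V] [BorelSpace V]

theorem continuous_fourier {u : V → ℂ} (hu : Integrable u) : Continuous (𝓕 u) :=
  VectorFourier.fourierIntegral_continuous Real.continuous_fourierChar
    (innerSL ℝ).continuous₂ hu

theorem integral_fourier_mul {u φ : V → ℂ} (hu : Integrable u) (hφ : Integrable φ) :
    ∫ ξ, 𝓕 u ξ * φ ξ = ∫ x, u x * 𝓕 φ x := by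
  have h := VectorFourier.integral_fourierIntegral_smul_eq_flip
    (L := innerₗ V) (μ := volume) (ν := volume)
    Real.continuous_fourierChar (innerSL ℝ).continuous₂ hu hφ
  rw [flip_innerₗ] at h
  exact h

theorem fourier_comp_add_sub {u : V → ℂ} (hu : Integrable u) (h ξ : V) :
    𝓕 (fun x => u (x + h) - u x) ξ = ((Real.fourierChar (inner ℝ ξ h) : ℂ) - 1) * 𝓕 u ξ := by
  have h1 : 𝓕 (fun x => u (x + h)) ξ = (Real.fourierChar (inner ℝ ξ h) : ℂ) * 𝓕 u ξ := by
    have := congrFun (VectorFourier.fourierIntegral_comp_add_right Real.fourierChar volume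
      (innerₗ V) u h) ξ
    rw [real_inner_comm]
    exact this
  rw [sub_mul, one_mul, ← h1]
  simp only [Real.fourier_eq, smul_sub]
  exact integral_sub ((Real.fourierIntegral_convergent_iff _).2 (hu.comp_add_right h))
    ((Real.fourierIntegral_convergent_iff _).2 hu)

/-- The transform is bounded, so duality applies without assuming u in L²: the pairing moves to u,
and Plancherel is needed only for Schwartz ψ. -/
theorem lintegral_enorm_sq_fourier_le {u : V → ℂ} (hu : Integrable u) :
    ∫⁻ ξ, ‖𝓕 u ξ‖ₑ ^ 2 ≤ ∫⁻ x, ‖u x‖ₑ ^ 2 := by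
  refine lintegral_enorm_sq_le_of_bounded (C := ∫ x, ‖u x‖)
    (continuous_fourier hu).aestronglyMeasurable
    (fun ξ => VectorFourier.norm_fourierIntegral_le_integral_norm _ _ _ _ _) fun ψ => ?_
  rw [integral_fourier_mul hu ψ.integrable, ← lintegral_enorm_sq_fourier]
  calc _ ≤ (∫⁻ x, ‖u x‖ₑ * ‖𝓕 ψ x‖ₑ) ^ 2 := by
        gcongr
        simpa only [enorm_mul] using! enorm_integral_le_lintegral_enorm fun x => u x * 𝓕 ψ x
    _ ≤ _ := sq_lintegral_mul_le hu.aestronglyMeasurable.enorm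
        (𝓕 ψ).continuous.enorm.measurable.aemeasurable

end Fourier

/-! ### Dyadic decomposition of the Gaussian weight -/

/-- For s > 1 take the least k with s ≤ 2^k; then 2^k < 2s gives s ≤ 2 · 2^{-k} s². Beyond k = N one
has εs ≥ 1, and the Gaussian supplies the decay in j. -/
theorem exists_mul_exp_neg_le {ε s a : ℝ} (hε : 0 < ε) (hs : 0 ≤ s) (ha : 1 ≤ a) {N : ℕ}
    (hN : 1 ≤ 2 ^ N * ε) :
    s * Real.exp (-a * ε ^ 2 * s ^ 2) ≤ 1 ∨
    (∃ k < N + 1, s ≤ 2 ^ k ∧ s * Real.exp (-a * ε ^ 2 * s ^ 2) ≤ 2 * ((1 / 2) ^ k * s ^ 2)) ∨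
    ∃ j : ℕ, s ≤ 2 ^ (N + j) ∧ s * Real.exp (-a * ε ^ 2 * s ^ 2) ≤
      8 * (1 / 4) ^ j * ((1 / 2) ^ (N + j) * s ^ 2) := by
  have hexp1 : Real.exp (-a * ε ^ 2 * s ^ 2) ≤ 1 := by
    rw [Real.exp_le_one_iff]
    have : 0 ≤ a * ε ^ 2 * s ^ 2 := by positivity
    linarith
  rcases le_or_gt s 1 with h1 | h1
  · left
    exact mul_le_one₀ h1 (Real.exp_pos _).le hexp1
  right
  have hex : ∃ k : ℕ, s ≤ 2 ^ k := by
    obtain ⟨j, hj⟩ := pow_unbounded_of_one_lt s one_lt_two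
    exact ⟨j, hj.le⟩
  classical
  obtain ⟨k, hk, hmin⟩ : ∃ k, s ≤ 2 ^ k ∧ ∀ m < k, ¬ s ≤ 2 ^ m :=
    ⟨Nat.find hex, Nat.find_spec hex, fun m hm => Nat.find_min hex hm⟩
  obtain ⟨i, rfl⟩ : ∃ i, k = i + 1 := by
    rcases k with _ | i
    · simp at hk
      linarith
    · exact ⟨i, rfl⟩
  have hi : 2 ^ i < s := not_le.1 (hmin i (by omega))
  have hs' : s ≤ 2 * ((1 / 2) ^ (i + 1) * s ^ 2) := by
    have h2 : 1 ≤ (1 / 2 : ℝ) ^ i * s := by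
      rw [one_div, inv_pow, le_inv_mul_iff₀ (by positivity), mul_one]
      exact hi.le
    rw [pow_succ]
    nlinarith
  rcases lt_or_ge (i + 1) (N + 1) with hlt | hge
  · left
    exact ⟨i + 1, hlt, hk, (mul_le_of_le_one_right hs hexp1).trans hs'⟩
  · right
    obtain ⟨j, rfl⟩ : ∃ j, i = N + j := ⟨i - N, by omega⟩
    -- The Gaussian gives only (1/4)^j for index j + 1; the lost factor 4 turns the constant 2 into
    -- 8.
    refine ⟨j + 1, hk, ?_⟩
    have hεs : (2 : ℝ) ^ j ≤ ε * s := by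
      rw [pow_add] at hi
      calc (2 : ℝ) ^ j ≤ 2 ^ j * (2 ^ N * ε) := le_mul_of_one_le_right (by positivity) hN
        _ = ε * (2 ^ N * 2 ^ j) := by ring
        _ ≤ _ := by gcongr
    have h4 : (4 : ℝ) ^ j ≤ a * ε ^ 2 * s ^ 2 := by
      have := pow_le_pow_left₀ (by positivity) hεs 2
      rw [← pow_mul, mul_comm j, pow_mul] at this
      norm_num at this
      nlinarith [sq_nonneg (ε * s)]
    have hexp : Real.exp (-a * ε ^ 2 * s ^ 2) ≤ (1 / 4) ^ j := by
      rw [neg_mul, neg_mul, Real.exp_neg, one_div, inv_pow]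
      refine inv_anti₀ (by positivity) (h4.trans ?_)
      linarith [Real.add_one_le_exp (a * ε ^ 2 * s ^ 2)]
    calc s * Real.exp (-a * ε ^ 2 * s ^ 2) ≤
        (2 * ((1 / 2) ^ (N + j + 1) * s ^ 2)) * (1 / 4) ^ j := by gcongr
      _ = _ := by
        rw [pow_succ (1 / 4 : ℝ) j, ← add_assoc]
        ring

/-- A density whose second moments over balls grow linearly with the radius has Gaussian means
growing at most logarithmically. -/
theorem lintegral_mul_exp_neg_le {V : Type*} [NormedAddCommGroup V] [MeasurableSpace V]
    [OpensMeasurableSpace V] {μ : Measure V} {G : V → ℝ≥0∞} (hG : AEMeasurable G μ) {a : ℝ}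
    (ha : 1 ≤ a) {A : ℝ≥0∞}
    (hA : ∀ k : ℕ, ∫⁻ ξ in Metric.closedBall 0 (2 ^ k),
      ENNReal.ofReal ((1 / 2) ^ k * ‖ξ‖ ^ 2) * G ξ ∂μ ≤ A)
    {ε : ℝ} (hε : 0 < ε) {N : ℕ} (hN : 1 ≤ 2 ^ N * ε) :
    ∫⁻ ξ, ENNReal.ofReal (‖ξ‖ * Real.exp (-a * ε ^ 2 * ‖ξ‖ ^ 2)) * G ξ ∂μ ≤
      (∫⁻ ξ, G ξ ∂μ) + (N + 1 : ℕ) * (2 * A) +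
        (∑' j : ℕ, ENNReal.ofReal (8 * (1 / 4) ^ j)) * A := by
  set U : ℕ → V → ℝ≥0∞ := fun k => (Metric.closedBall 0 (2 ^ k)).indicator
    fun ξ => ENNReal.ofReal ((1 / 2) ^ k * ‖ξ‖ ^ 2) * G ξ with hU
  have hball : ∀ k : ℕ, MeasurableSet (Metric.closedBall (0 : V) (2 ^ k)) := fun k =>
    Metric.isClosed_closedBall.measurableSet
  have hUm : ∀ k, AEMeasurable (U k) μ := fun k =>
    (((measurable_norm.pow_const 2).const_mul _).ennreal_ofReal.aemeasurable.mul hG).indicator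
      (hball k)
  have hUi : ∀ k, ∫⁻ ξ, U k ξ ∂μ ≤ A := fun k => by
    rw [lintegral_indicator (hball k)]
    exact hA k
  calc _ ≤ ∫⁻ ξ, (G ξ + ∑ k ∈ Finset.range (N + 1), 2 * U k ξ +
        ∑' j : ℕ, ENNReal.ofReal (8 * (1 / 4) ^ j) * U (N + j) ξ) ∂μ := by
        refine lintegral_mono fun ξ => ?_
        rcases exists_mul_exp_neg_le hε (norm_nonneg ξ) ha hN with h | ⟨k, hk, hks, h⟩ | ⟨j, hj, h⟩
        · refine le_trans ?_ (le_self_add.trans le_self_add)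
          exact mul_le_of_le_one_left (by positivity) (ENNReal.ofReal_le_one.2 h)
        · refine le_trans ?_ (le_add_self.trans le_self_add)
          refine le_trans ?_ (Finset.single_le_sum (f := fun k => 2 * U k ξ)
            (fun _ _ => by positivity) (Finset.mem_range.2 hk))
          simp only [hU]
          rw [indicator_of_mem (by simpa using hks), ← mul_assoc]
          gcongr
          refine (ENNReal.ofReal_le_ofReal h).trans (le_of_eq ?_)
          rw [ENNReal.ofReal_mul (by norm_num)]
          norm_num
        · refine le_trans ?_ le_add_self
          refine le_trans ?_ (ENNReal.le_tsum j)
          simp only [hU]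
          rw [indicator_of_mem (by simpa using hj), ← mul_assoc, ← ENNReal.ofReal_mul (by positivity)]
          gcongr
    _ = (∫⁻ ξ, G ξ ∂μ) + ∑ k ∈ Finset.range (N + 1), 2 * ∫⁻ ξ, U k ξ ∂μ +
        ∑' j : ℕ, ENNReal.ofReal (8 * (1 / 4) ^ j) * ∫⁻ ξ, U (N + j) ξ ∂μ := by
        have h2 : ∀ k, AEMeasurable (fun ξ => 2 * U k ξ) μ := fun k => (hUm k).const_mul 2
        have h3 : AEMeasurable (fun ξ => G ξ + ∑ k ∈ Finset.range (N + 1), 2 * U k ξ) μ :=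
          hG.add (Finset.aemeasurable_fun_sum _ fun k _ => h2 k)
        rw [lintegral_add_left' h3,
          lintegral_add_left' hG, lintegral_finsetSum' _ fun k _ => h2 k,
          lintegral_tsum fun j => (hUm (N + j)).const_mul _]
        simp only [fun k => lintegral_const_mul'' (2 : ℝ≥0∞) (hUm k),
          fun j => lintegral_const_mul'' (ENNReal.ofReal (8 * (1 / 4) ^ j)) (hUm (N + j))]
    _ ≤ (∫⁻ ξ, G ξ ∂μ) + ∑ k ∈ Finset.range (N + 1), 2 * A +
        ∑' j : ℕ, ENNReal.ofReal (8 * (1 / 4) ^ j) * A := by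
        gcongr with k _ j
        · exact hUi k
        · exact hUi (N + j)
    _ = _ := by
        rw [Finset.sum_const, Finset.card_range, nsmul_eq_mul, ENNReal.tsum_mul_right]

/-! ### Transforms of sets of finite measure and of their complements -/

theorem isFourierAwayFromZero_fourier {u : 𝔼 → ℂ} (hu : Integrable u) :
    IsFourierAwayFromZero u (𝓕 u) :=
  ⟨(continuous_fourier hu).locallyIntegrable.locallyIntegrableOn _,
    fun φ _ _ => integral_fourier_mul hu φ.integrable⟩

/-- The two indicators add up to 1, whose transform lives at the origin: ∫ 𝓕 φ = φ(0) = 0 for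
admissible φ. -/
theorem isFourierAwayFromZero_compl {E : Set 𝔼} (hE : MeasurableSet E) {g : 𝔼 → ℂ}
    (hg : IsFourierAwayFromZero (fun x => ((Eᶜ.indicator (fun _ => (1 : ℝ)) x : ℝ) : ℂ)) g) :
    IsFourierAwayFromZero (fun x => ((E.indicator (fun _ => (1 : ℝ)) x : ℝ) : ℂ))
      (fun ξ => -g ξ) := by
  refine ⟨hg.1.neg, fun φ hφ hs => ?_⟩
  have h0 : φ 0 = 0 := by
    by_contra h
    exact hs (subset_tsupport _ h) rfl
  have hint : ∫ x, 𝓕 φ x = 0 := by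
    have : 𝓕⁻ (𝓕 φ) 0 = 0 := by rw [FourierTransform.fourierInv_fourier_eq, h0]
    rw [SchwartzMap.fourierInv_coe, Real.fourierInv_eq] at this
    simpa using this
  have hm : ∀ A : Set 𝔼, MeasurableSet A → Integrable fun x =>
      ((A.indicator (fun _ => (1 : ℝ)) x : ℝ) : ℂ) * 𝓕 φ x := fun A hA =>
    (𝓕 φ).integrable.bdd_mul (c := 1) (Complex.continuous_ofReal.comp_aestronglyMeasurable
      (measurable_const.indicator hA).aestronglyMeasurable)
      (.of_forall fun x => by simpa using norm_indicator_one_le A x)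
  have hsum : (∫ x, ((E.indicator (fun _ => (1 : ℝ)) x : ℝ) : ℂ) * 𝓕 φ x) +
      ∫ x, ((Eᶜ.indicator (fun _ => (1 : ℝ)) x : ℝ) : ℂ) * 𝓕 φ x = 0 := by
    rw [← integral_add (hm E hE) (hm Eᶜ hE.compl), ← hint]
    refine integral_congr_ae (.of_forall fun x => ?_)
    by_cases hx : x ∈ E <;> simp [hx]
  simp only [neg_mul]
  rw [integral_neg, hg.2 φ hφ hs]
  exact (eq_neg_of_add_eq_zero_left hsum).symm

/-! ### From finite perimeter to L¹ bounds on translates -/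

theorem divergence_smul_single {ψ : 𝔼 → ℝ} (hψ : Differentiable ℝ ψ) (i : Fin n) (x : 𝔼) :
    divergence (fun y => ψ y • EuclideanSpace.single i (1 : ℝ)) x =
      fderiv ℝ ψ x (EuclideanSpace.single i 1) := by
  rw [divergence, fderiv_smul_const (hψ x)]
  simp

theorem norm_setIntegral_fderiv_le_perimeter {E : Set 𝔼} (hP : perimeter E ≠ ⊤) {ψ : 𝔼 → ℝ}
    (hψ : ContDiff ℝ 1 ψ) (hc : HasCompactSupport ψ) (h1 : ∀ x, ‖ψ x‖ ≤ 1) (i : Fin n) :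
    ‖∫ x in E, fderiv ℝ ψ x (EuclideanSpace.single i 1)‖ ≤ (perimeter E).toReal := by
  have key : ∀ ψ : 𝔼 → ℝ, ContDiff ℝ 1 ψ → HasCompactSupport ψ → (∀ x, ‖ψ x‖ ≤ 1) →
      ∫ x in E, fderiv ℝ ψ x (EuclideanSpace.single i 1) ≤ (perimeter E).toReal := by
    intro ψ hψ hc h1
    have h := le_iSup₂_of_le (f := fun (φ : 𝔼 → 𝔼)
        (_ : ContDiff ℝ 1 φ ∧ HasCompactSupport φ ∧ ∀ x, ‖φ x‖ ≤ 1) =>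
        ENNReal.ofReal (∫ x in E, divergence φ x))
      (fun y => ψ y • EuclideanSpace.single i (1 : ℝ))
      ⟨hψ.smul contDiff_const, hc.smul_right, fun x => by simpa [norm_smul] using h1 x⟩ le_rfl
    simp only [divergence_smul_single (hψ.differentiable (by norm_num))] at h
    exact (ENNReal.ofReal_le_iff_le_toReal hP).1 h
  rw [Real.norm_eq_abs, abs_le']
  refine ⟨key ψ hψ hc h1, ?_⟩
  have := key (fun x => -ψ x) hψ.neg hc.neg (fun x => by simpa using h1 x)
  simpa [fderiv_fun_neg, integral_neg] using this

theorem integral_fderiv_eq_zero {ψ : 𝔼 → ℝ} (hψ : ContDiff ℝ 1 ψ) (hc : HasCompactSupport ψ)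
    (v : 𝔼) : ∫ x, fderiv ℝ ψ x v = 0 := by
  have h := hasDerivAt_integral_mul_comp_add_smul (F := fun _ : 𝔼 => (1 : ℝ))
    (locallyIntegrable_const 1) hψ hc v 0
  simp only [one_mul, integral_add_right_eq_self, zero_smul, add_zero] at h
  exact h.unique (hasDerivAt_const _ _)

theorem norm_setIntegral_compl_fderiv {E : Set 𝔼} (hE : MeasurableSet E) {ψ : 𝔼 → ℝ}
    (hψ : ContDiff ℝ 1 ψ) (hc : HasCompactSupport ψ) (v : 𝔼) :
    ‖∫ x in Eᶜ, fderiv ℝ ψ x v‖ = ‖∫ x in E, fderiv ℝ ψ x v‖ := by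
  have hint : Integrable fun x => fderiv ℝ ψ x v :=
    ((hψ.continuous_fderiv (by norm_num)).clm_apply
      continuous_const).integrable_of_hasCompactSupport (hc.fderiv_apply ℝ _)
  have h := integral_add_compl hE hint
  rw [integral_fderiv_eq_zero hψ hc] at h
  rw [eq_neg_of_add_eq_zero_right h, norm_neg]

/-- Translates of ψ are again admissible, so s ↦ ∫ f(x) ψ(x + sv) has derivative bounded by K, and
the mean value inequality applies. -/
theorem norm_integral_difference_mul_le {E : Set 𝔼} (hE : MeasurableSet E) {v : 𝔼} {K : ℝ}
    (hK : ∀ ψ : 𝔼 → ℝ, ContDiff ℝ 1 ψ → HasCompactSupport ψ → (∀ x, ‖ψ x‖ ≤ 1) →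
      ‖∫ x in E, fderiv ℝ ψ x v‖ ≤ K) {ψ : 𝔼 → ℝ} (hψ : ContDiff ℝ 1 ψ)
    (hc : HasCompactSupport ψ) (h1 : ∀ x, ‖ψ x‖ ≤ 1) {t : ℝ} (ht : 0 ≤ t) :
    ‖∫ x, (E.indicator (fun _ => (1 : ℝ)) (x + t • v) - E.indicator (fun _ => (1 : ℝ)) x) * ψ x‖ ≤
      t * K := by
  set f : 𝔼 → ℝ := E.indicator fun _ => (1 : ℝ) with hf
  have hfm : Measurable f := measurable_const.indicator hE
  have hbd : ∀ x, ‖f x‖ ≤ 1 := norm_indicator_one_le E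
  have hψi : Integrable ψ := hψ.continuous.integrable_of_hasCompactSupport hc
  have hint : ∀ y : 𝔼, Integrable fun x => f x * ψ (x + y) := fun y =>
    (hψi.comp_add_right y).bdd_mul hfm.aestronglyMeasurable (.of_forall hbd)
  have hd := fun s : ℝ => hasDerivAt_integral_mul_comp_add_smul
    (locallyIntegrable_indicator_one hE) hψ hc v s
  have hd' : ∀ s : ℝ, ‖∫ x, f x * fderiv ℝ ψ (x + s • v) v‖ ≤ K := fun s => by
    have := hK (fun x => ψ (x + s • v)) (hψ.comp (contDiff_id.add contDiff_const))
      (hc.comp_homeomorph (Homeomorph.addRight (s • v))) (fun x => h1 _)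
    simp only [fderiv_comp_add_right] at this
    rwa [hf, integral_indicator_one_mul hE]
  have hmv := convex_univ.norm_image_sub_le_of_norm_hasDerivWithin_le
    (fun s _ => (hd s).hasDerivWithinAt) (fun s _ => hd' s) (mem_univ 0) (mem_univ (-t))
  simp only [zero_smul, add_zero, sub_zero, norm_neg, Real.norm_of_nonneg ht] at hmv
  rw [integral_difference_mul hfm.aestronglyMeasurable hbd hψi, mul_comm]
  refine le_trans (le_of_eq ?_) hmv
  rw [← integral_sub (hint _) (by simpa using hint 0)]
  simp only [neg_smul, sub_eq_add_neg, mul_add, mul_neg]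
  rfl

/-- The map sin(π/2 ·) fixes -1, 0 and 1, is Lipschitz and has values in [-1, 1]. It thus turns an
L¹ approximation of w into an admissible test function without losing closeness to w. -/
theorem abs_sub_sin_le {w z : ℝ} (hw : w = -1 ∨ w = 0 ∨ w = 1) :
    |w - Real.sin (Real.pi / 2 * z)| ≤ Real.pi / 2 * |w - z| := by
  have h : w = Real.sin (Real.pi / 2 * w) := by
    rcases hw with rfl | rfl | rfl <;> simp
  have hl : |Real.sin (Real.pi / 2 * w) - Real.sin (Real.pi / 2 * z)| ≤
      |Real.pi / 2 * w - Real.pi / 2 * z| := Real.abs_sin_sub_sin_le _ _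
  rw [← h, ← mul_sub, abs_mul, abs_of_pos (show 0 < Real.pi / 2 by positivity)] at hl
  exact hl

/-- Since |w| = w², w is its own optimal dual function. It is replaced by a smooth, compactly
supported ψ with |ψ| ≤ 1 at an arbitrarily small L¹ cost. -/
theorem lintegral_difference_le {E : Set 𝔼} (hE : MeasurableSet E) (hfin : volume E ≠ ⊤) {v : 𝔼}
    {K : ℝ} (hK : ∀ ψ : 𝔼 → ℝ, ContDiff ℝ 1 ψ → HasCompactSupport ψ → (∀ x, ‖ψ x‖ ≤ 1) →
      ‖∫ x in E, fderiv ℝ ψ x v‖ ≤ K) {t : ℝ} (ht : 0 ≤ t) :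
    ∫⁻ x, ‖E.indicator (fun _ => (1 : ℝ)) (x + t • v) - E.indicator (fun _ => (1 : ℝ)) x‖ₑ ≤
      ENNReal.ofReal (t * K) := by
  set f : 𝔼 → ℝ := E.indicator fun _ => (1 : ℝ) with hf
  have hfi : Integrable f := (integrable_indicator_iff hE).2 (integrableOn_const hfin)
  set w : 𝔼 → ℝ := fun x => f (x + t • v) - f x with hw
  have hwi : Integrable w := (hfi.comp_add_right _).sub hfi
  have hw3 : ∀ x, w x = -1 ∨ w x = 0 ∨ w x = 1 := fun x => by
    by_cases h1 : x ∈ E <;> by_cases h2 : x + t • v ∈ E <;> simp [hw, hf, h1, h2]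
  have hw1 : ∀ x, ‖w x‖ ≤ 1 := fun x => by rcases hw3 x with h | h | h <;> simp [h]
  have habs : ∀ x, ‖w x‖ = w x * w x := fun x => by rcases hw3 x with h | h | h <;> simp [h]
  rw [← ofReal_integral_norm_eq_lintegral_enorm hwi]
  refine ENNReal.ofReal_le_ofReal ?_
  refine le_of_forall_pos_le_add fun η hη => ?_
  have hπ : 0 < Real.pi / 2 := by positivity
  obtain ⟨ζ, hζc, hζd, hζ⟩ := MemLp.exist_eLpNorm_sub_le (p := 1) (by norm_num) le_rfl
    (memLp_one_iff_integrable.2 hwi) (ε := η / (Real.pi / 2)) (by positivity)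
  have hζi : Integrable ζ := hζd.continuous.integrable_of_hasCompactSupport hζc
  have hζ' : ∫ x, |w x - ζ x| ≤ η / (Real.pi / 2) := by
    rw [eLpNorm_one_eq_lintegral_enorm, ← ofReal_integral_norm_eq_lintegral_enorm (hwi.sub hζi)] at hζ
    exact (ENNReal.ofReal_le_ofReal_iff (by positivity)).1 hζ
  set ψ : 𝔼 → ℝ := fun x => Real.sin (Real.pi / 2 * ζ x) with hψdef
  have hψd : ContDiff ℝ 1 ψ :=
    Real.contDiff_sin.comp (contDiff_const.mul (hζd.of_le (by exact_mod_cast le_top)))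
  have hψc : HasCompactSupport ψ :=
    hζc.comp_left (g := fun r => Real.sin (Real.pi / 2 * r)) (by simp)
  have hψi : Integrable ψ := hψd.continuous.integrable_of_hasCompactSupport hψc
  have hψ1 : ∀ x, ‖ψ x‖ ≤ 1 := fun x => Real.abs_sin_le_one _
  have hmain := norm_integral_difference_mul_le hE hK hψd hψc hψ1 ht
  have hI1 : Integrable fun x => w x * (w x - ψ x) :=
    (hwi.sub hψi).bdd_mul hwi.aestronglyMeasurable (.of_forall hw1)
  have hI2 : Integrable fun x => w x * ψ x :=
    hψi.bdd_mul hwi.aestronglyMeasurable (.of_forall hw1)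
  have hsplit : ∫ x, ‖w x‖ = (∫ x, w x * ψ x) + ∫ x, w x * (w x - ψ x) := by
    rw [← integral_add hI2 hI1]
    refine integral_congr_ae (.of_forall fun x => ?_)
    simp only [habs]
    ring
  rw [hsplit]
  refine add_le_add ((Real.le_norm_self _).trans hmain) ?_
  calc ∫ x, w x * (w x - ψ x) ≤ ∫ x, Real.pi / 2 * |w x - ζ x| := by
        refine integral_mono hI1 ((hwi.sub hζi).abs.const_mul _) fun x => ?_
        refine (le_abs_self _).trans ?_
        rw [abs_mul]
        exact (mul_le_of_le_one_left (abs_nonneg _) (hw1 x)).trans (abs_sub_sin_le (hw3 x))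
    _ = Real.pi / 2 * ∫ x, |w x - ζ x| := integral_const_mul _ _
    _ ≤ Real.pi / 2 * (η / (Real.pi / 2)) := by gcongr
    _ = η := by field_simp

/-! ### Logarithmic growth for sets of finite perimeter -/

theorem sixteen_mul_sq_le_norm_fourierChar_sub_one_sq {x : ℝ} (hx : |x| ≤ 1 / 2) :
    16 * x ^ 2 ≤ ‖(Real.fourierChar x : ℂ) - 1‖ ^ 2 := by
  have h : 2 * |x| ≤ |Real.sin (Real.pi * x)| := by
    have h1 := Real.mul_abs_le_abs_sin (x := Real.pi * x) (by
      rw [abs_mul, abs_of_pos Real.pi_pos]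
      nlinarith [Real.pi_pos])
    rw [abs_mul, abs_of_pos Real.pi_pos, ← mul_assoc, div_mul_cancel₀ _ Real.pi_ne_zero] at h1
    exact h1
  rw [norm_fourierChar_sub_one]
  have h2 := pow_le_pow_left₀ (by positivity) h 2
  rw [mul_pow, sq_abs] at h2
  rw [mul_pow]
  linarith

theorem setLIntegral_closedBall_norm_sq_mul_le {E : Set 𝔼} (hE : MeasurableSet E)
    (hfin : volume E ≠ ⊤) {K : ℝ}
    (hK : ∀ i : Fin n, ∀ ψ : 𝔼 → ℝ, ContDiff ℝ 1 ψ → HasCompactSupport ψ → (∀ x, ‖ψ x‖ ≤ 1) →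
      ‖∫ x in E, fderiv ℝ ψ x (EuclideanSpace.single i 1)‖ ≤ K) (k : ℕ) :
    ∫⁻ ξ in Metric.closedBall (0 : 𝔼) (2 ^ k), ENNReal.ofReal ((1 / 2) ^ k * ‖ξ‖ ^ 2) *
      ‖𝓕 (fun x => ((E.indicator (fun _ => (1 : ℝ)) x : ℝ) : ℂ)) ξ‖ₑ ^ 2 ≤
      ENNReal.ofReal (n * K) := by
  set f : 𝔼 → ℂ := fun x => ((E.indicator (fun _ => (1 : ℝ)) x : ℝ) : ℂ) with hf
  have hfi : Integrable f := Integrable.ofReal (𝕜 := ℂ)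
    ((integrable_indicator_iff hE).2 (integrableOn_const hfin))
  -- With this step |t ξ_i| ≤ 1/2 on the ball of radius 2^k, the range where |exp(2πix) - 1| ≥ 4|x|.
  set t : ℝ := (1 / 2) ^ (k + 1) with ht
  have ht0 : 0 < t := by positivity
  have hki : ∀ i : Fin n, ∫⁻ ξ, ‖(Real.fourierChar (t * ξ i) : ℂ) - 1‖ₑ ^ 2 * ‖𝓕 f ξ‖ₑ ^ 2 ≤
      ENNReal.ofReal (t * K) := fun i => by
    have h1 := lintegral_enorm_sq_fourier_le
      ((hfi.comp_add_right (t • EuclideanSpace.single i (1 : ℝ))).sub hfi)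
    refine le_trans (le_of_eq ?_) (h1.trans ?_)
    · refine lintegral_congr fun ξ => ?_
      have := fourier_comp_add_sub hfi (t • EuclideanSpace.single i (1 : ℝ)) ξ
      rw [inner_smul_right, EuclideanSpace.inner_single_right] at this
      simp only [one_mul, conj_trivial] at this
      rw [← mul_pow, ← enorm_mul, ← this]
      rfl
    · refine le_trans (le_of_eq ?_) (lintegral_difference_le hE hfin (hK i) ht0.le)
      exact lintegral_congr fun x => enorm_indicator_sub_sq E _ _
  have hcont : Continuous (𝓕 f) := continuous_fourier hfi
  have hm : ∀ i : Fin n, AEMeasurable (fun ξ : 𝔼 => ENNReal.ofReal t⁻¹ *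
      (‖(Real.fourierChar (t * ξ i) : ℂ) - 1‖ₑ ^ 2 * ‖𝓕 f ξ‖ₑ ^ 2)) := fun i => by
    have h1 : Continuous fun ξ : 𝔼 => (Real.fourierChar (t * ξ i) : ℂ) - 1 := by
      have : Continuous fun ξ : 𝔼 => t * ξ i := by fun_prop
      exact (continuous_subtype_val.comp (Real.continuous_fourierChar.comp this)).sub
        continuous_const
    exact ((h1.enorm.measurable.pow_const 2).mul
      (hcont.enorm.measurable.pow_const 2)).aemeasurable.const_mul _
  calc _ ≤ ∫⁻ ξ in Metric.closedBall (0 : 𝔼) (2 ^ k), ∑ i : Fin n, ENNReal.ofReal t⁻¹ *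
        (‖(Real.fourierChar (t * ξ i) : ℂ) - 1‖ₑ ^ 2 * ‖𝓕 f ξ‖ₑ ^ 2) := by
        refine setLIntegral_mono' Metric.isClosed_closedBall.measurableSet fun ξ hξ => ?_
        have hξ : ‖ξ‖ ≤ 2 ^ k := by simpa using hξ
        simp only [← mul_assoc]
        rw [← Finset.sum_mul]
        gcongr
        rw [EuclideanSpace.norm_sq_eq, Finset.mul_sum,
          ENNReal.ofReal_sum_of_nonneg fun _ _ => by positivity]
        refine Finset.sum_le_sum fun i _ => ?_
        rw [← ofReal_norm, ← ENNReal.ofReal_pow (norm_nonneg _),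
          ← ENNReal.ofReal_mul (by positivity)]
        refine ENNReal.ofReal_le_ofReal ?_
        have h2k : t * 2 ^ k = 1 / 2 := by
          rw [ht, pow_succ, one_div, inv_pow]
          field_simp
        have hx : |t * ξ i| ≤ 1 / 2 := by
          rw [abs_mul, abs_of_pos ht0, ← h2k]
          gcongr
          exact (PiLp.norm_apply_le ξ i).trans hξ
        refine le_trans ?_ (mul_le_mul_of_nonneg_left
          (sixteen_mul_sq_le_norm_fourierChar_sub_one_sq hx) (by positivity))
        have h3 : (1 / 2 : ℝ) ^ k = 2 * t := by rw [ht, pow_succ]; ring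
        rw [h3, Real.norm_eq_abs, sq_abs]
        have h4 : t⁻¹ * (16 * (t * ξ i) ^ 2) = 16 * (t * ξ i ^ 2) := by field_simp
        rw [h4]
        nlinarith [mul_nonneg ht0.le (sq_nonneg (ξ i))]
    _ ≤ ∫⁻ ξ, ∑ i : Fin n, ENNReal.ofReal t⁻¹ *
        (‖(Real.fourierChar (t * ξ i) : ℂ) - 1‖ₑ ^ 2 * ‖𝓕 f ξ‖ₑ ^ 2) :=
      setLIntegral_le_lintegral _ _
    _ = ∑ i : Fin n, ENNReal.ofReal t⁻¹ *
        ∫⁻ ξ, ‖(Real.fourierChar (t * ξ i) : ℂ) - 1‖ₑ ^ 2 * ‖𝓕 f ξ‖ₑ ^ 2 := by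
      rw [lintegral_finsetSum' _ fun i _ => hm i]
      exact Finset.sum_congr rfl fun i _ => lintegral_const_mul' _ _ ENNReal.ofReal_ne_top
    _ ≤ ∑ i : Fin n, ENNReal.ofReal t⁻¹ * ENNReal.ofReal (t * K) := by
      gcongr with i
      exact hki i
    _ = _ := by
      rw [← ENNReal.ofReal_mul (by positivity), inv_mul_cancel_left₀ ht0.ne', Finset.sum_const,
        Finset.card_univ, Fintype.card_fin, nsmul_eq_mul, ENNReal.ofReal_mul (by positivity),
        ENNReal.ofReal_natCast]

theorem exists_eventually_lintegral_fourier_le {E : Set 𝔼} (hE : MeasurableSet E)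
    (hfin : volume E ≠ ⊤) {K : ℝ}
    (hK : ∀ i : Fin n, ∀ ψ : 𝔼 → ℝ, ContDiff ℝ 1 ψ → HasCompactSupport ψ → (∀ x, ‖ψ x‖ ≤ 1) →
      ‖∫ x in E, fderiv ℝ ψ x (EuclideanSpace.single i 1)‖ ≤ K) :
    ∃ C : ℝ≥0∞, C ≠ ⊤ ∧ ∀ᶠ ε in 𝓝[>] (0 : ℝ),
      ∫⁻ ξ, ENNReal.ofReal (‖ξ‖ * Real.exp (-4 * Real.pi ^ 2 * ε ^ 2 * ‖ξ‖ ^ 2)) *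
        ‖𝓕 (fun x => ((E.indicator (fun _ => (1 : ℝ)) x : ℝ) : ℂ)) ξ‖ₑ ^ 2 ≤
      C * ENNReal.ofReal |Real.log ε| := by
  set f : 𝔼 → ℂ := fun x => ((E.indicator (fun _ => (1 : ℝ)) x : ℝ) : ℂ) with hf
  have hfi : Integrable f := Integrable.ofReal (𝕜 := ℂ)
    ((integrable_indicator_iff hE).2 (integrableOn_const hfin))
  set A : ℝ≥0∞ := ENNReal.ofReal (n * K)
  set S : ℝ≥0∞ := ∑' j : ℕ, ENNReal.ofReal (8 * (1 / 4) ^ j) with hS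
  have hS_fin : S ≠ ⊤ := Summable.tsum_ofReal_ne_top
    ((summable_geometric_of_lt_one (by norm_num) (by norm_num)).mul_left _)
  have hL2 : ∫⁻ ξ, ‖𝓕 f ξ‖ₑ ^ 2 ≤ volume E := by
    refine (lintegral_enorm_sq_fourier_le hfi).trans (le_of_eq ?_)
    rw [← lintegral_indicator_one hE]
    refine lintegral_congr fun x => ?_
    by_cases hx : x ∈ E <;> simp [hf, hx]
  refine ⟨volume E + 4 * (2 * A) + S * A, by finiteness, ?_⟩
  have hlog : ∀ᶠ ε in 𝓝[>] (0 : ℝ), Real.log ε ≤ -1 :=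
    Real.tendsto_log_nhdsGT_zero.eventually (eventually_le_atBot _)
  filter_upwards [hlog, self_mem_nhdsWithin] with ε hlog hε
  have hε : 0 < ε := hε
  have habs : |Real.log ε| = -Real.log ε := abs_of_nonpos (by linarith)
  obtain ⟨N, hN, hN'⟩ : ∃ N : ℕ, 1 ≤ 2 ^ N * ε ∧ (N : ℝ) + 1 ≤ 4 * |Real.log ε| := by
    -- The factor 2 suffices for 2^N ε ≥ 1 because log 2 > 1/2; then N + 1 ≤ 2|log ε| + 2 ≤ 4|log ε|
    -- since |log ε| ≥ 1.
    refine ⟨⌈2 * |Real.log ε|⌉₊, ?_, ?_⟩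
    · rw [← Real.log_nonneg_iff (by positivity), Real.log_mul (by positivity) hε.ne', Real.log_pow]
      have h1 := Nat.le_ceil (2 * |Real.log ε|)
      have h2 := Real.log_two_gt_d9
      rw [habs] at h1 ⊢
      nlinarith
    · have := Nat.ceil_lt_add_one (show 0 ≤ 2 * |Real.log ε| by positivity)
      rw [habs] at this ⊢
      linarith
  have hmain := lintegral_mul_exp_neg_le (G := fun ξ => ‖𝓕 f ξ‖ₑ ^ 2) (μ := volume)
    ((continuous_fourier hfi).enorm.measurable.pow_const 2).aemeasurable
    (a := 4 * Real.pi ^ 2) (by nlinarith [Real.pi_gt_three])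
    (setLIntegral_closedBall_norm_sq_mul_le hE hfin hK) hε hN
  rw [show -(4 * Real.pi ^ 2) = -4 * Real.pi ^ 2 by ring] at hmain
  refine hmain.trans ?_
  set l := ENNReal.ofReal |Real.log ε| with hl
  have hl1 : 1 ≤ l := by
    rw [hl, ENNReal.one_le_ofReal, habs]
    linarith
  have hNl : ((N + 1 : ℕ) : ℝ≥0∞) ≤ 4 * l := by
    rw [← ENNReal.ofReal_natCast, show (4 : ℝ≥0∞) = ENNReal.ofReal 4 by norm_num, hl,
      ← ENNReal.ofReal_mul (by norm_num)]
    refine ENNReal.ofReal_le_ofReal ?_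
    push_cast
    exact hN'
  calc _ ≤ volume E * l + (4 * l) * (2 * A) + (S * A) * l := by
        refine add_le_add (add_le_add ?_ (mul_le_mul_left hNl _)) ?_
        · exact hL2.trans (le_mul_of_one_le_right (by positivity) hl1)
        · exact le_mul_of_one_le_right (by positivity) hl1
    _ = _ := by ring

/-! ### The two implications and the passage to null measurable sets -/

theorem limsup_energy_lt_top_of_eventually {E : Set 𝔼} {C : ℝ≥0∞} (hC : C ≠ ⊤)
    (h : ∀ᶠ ε in 𝓝[>] (0 : ℝ), hHalfNormSq (fun x => (smoothedIndicator ε E x : ℂ)) ≤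
      C * ENNReal.ofReal |Real.log ε|) : limsup (energy E) (𝓝[>] (0 : ℝ)) < ⊤ := by
  refine lt_of_le_of_lt (limsup_le_of_le (h := ?_)) hC.lt_top
  filter_upwards [h] with ε hε
  rw [energy, mul_comm, ← div_eq_mul_inv]
  exact ENNReal.div_le_of_le_mul hε

theorem limsup_energy_lt_top {E : Set 𝔼} (hE : MeasurableSet E)
    (hfin : volume E ≠ ⊤ ∨ volume Eᶜ ≠ ⊤) (hP : perimeter E < ⊤) :
    limsup (energy E) (𝓝[>] (0 : ℝ)) < ⊤ := by
  have hK : ∀ i : Fin n, ∀ ψ : 𝔼 → ℝ, ContDiff ℝ 1 ψ → HasCompactSupport ψ → (∀ x, ‖ψ x‖ ≤ 1) →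
      ‖∫ x in E, fderiv ℝ ψ x (EuclideanSpace.single i 1)‖ ≤ (perimeter E).toReal :=
    fun i ψ hψ hc h1 => norm_setIntegral_fderiv_le_perimeter hP.ne hψ hc h1 i
  have hint : ∀ A : Set 𝔼, MeasurableSet A → volume A ≠ ⊤ →
      Integrable fun x => ((A.indicator (fun _ => (1 : ℝ)) x : ℝ) : ℂ) := fun A hA hA' =>
    Integrable.ofReal (𝕜 := ℂ) ((integrable_indicator_iff hA).2 (integrableOn_const hA'))
  rcases hfin with hfin | hfin
  · obtain ⟨C, hC, h⟩ :=
      exists_eventually_lintegral_fourier_le hE hfin hK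
    refine limsup_energy_lt_top_of_eventually hC ?_
    filter_upwards [h, self_mem_nhdsWithin] with ε hε hε0
    rwa [hHalfNormSq_smoothedIndicator hE hε0 (isFourierAwayFromZero_fourier (hint E hE hfin))]
  · obtain ⟨C, hC, h⟩ := exists_eventually_lintegral_fourier_le hE.compl hfin
      fun i ψ hψ hc h1 =>
        (norm_setIntegral_compl_fderiv hE hψ hc _).trans_le (hK i ψ hψ hc h1)
    refine limsup_energy_lt_top_of_eventually hC ?_
    filter_upwards [h, self_mem_nhdsWithin] with ε hε hε0
    rw [hHalfNormSq_smoothedIndicator hE hε0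
      (isFourierAwayFromZero_compl hE (isFourierAwayFromZero_fourier (hint Eᶜ hE.compl hfin)))]
    simpa only [enorm_neg] using hε

theorem perimeter_lt_top {E : Set 𝔼} (hE : MeasurableSet E)
    (h : limsup (energy E) (𝓝[>] (0 : ℝ)) < ⊤) : perimeter E < ⊤ := by
  obtain ⟨C, hC, hC'⟩ := exists_between h
  refine perimeter_lt_top_of_eventually hE hC'.ne ?_
  have hlog : ∀ᶠ ε in 𝓝[>] (0 : ℝ), Real.log ε ≤ -1 :=
    Real.tendsto_log_nhdsGT_zero.eventually (eventually_le_atBot _)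
  filter_upwards [eventually_lt_of_limsup_lt hC, hlog] with ε hε hlog
  rw [energy, mul_comm, ← div_eq_mul_inv] at hε
  refine (ENNReal.div_le_iff ?_ ENNReal.ofReal_ne_top).1 hε.le
  rw [ne_eq, ENNReal.ofReal_eq_zero, not_le, abs_pos]
  linarith

theorem perimeter_congr {E E' : Set 𝔼} (h : E =ᵐ[volume] E') : perimeter E = perimeter E' := by
  simp only [perimeter, setIntegral_congr_set h]

theorem energy_congr {E E' : Set 𝔼} (h : E =ᵐ[volume] E') : energy E = energy E' := by
  have : ∀ ε : ℝ, smoothedIndicator ε E = smoothedIndicator ε E' := fun ε => by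
    unfold smoothedIndicator
    exact convolution_congr _ (ae_eq_refl _) (indicator_ae_eq_of_ae_eq_set h)
  funext ε
  simp only [energy, this]

end GaussPerimeter

theorem mainTheorem2 (n : ℕ) (E : Set (EuclideanSpace ℝ (Fin n)))
    (hE : NullMeasurableSet E volume) :
    (GaussPerimeter.perimeter E = ⊤ →
      limsup (GaussPerimeter.energy E) (𝓝[>] (0 : ℝ)) = ⊤) ∧
    ((volume E ≠ ⊤ ∨ volume Eᶜ ≠ ⊤) →
      (limsup (GaussPerimeter.energy E) (𝓝[>] (0 : ℝ)) < ⊤ ↔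
        GaussPerimeter.perimeter E < ⊤)) := by
  -- Perimeter, energy and volume see E only up to null sets, so E may be replaced by a measurable
  -- set.
  obtain ⟨E', -, hE', hEE'⟩ := hE.exists_measurable_superset_ae_eq
  rw [GaussPerimeter.perimeter_congr hEE'.symm, GaussPerimeter.energy_congr hEE'.symm,
    measure_congr hEE'.symm, measure_congr hEE'.symm.compl]
  refine ⟨fun h => ?_, fun hfin => ⟨GaussPerimeter.perimeter_lt_top hE',
    GaussPerimeter.limsup_energy_lt_top hE' hfin⟩⟩
  by_contra hne
  exact (GaussPerimeter.perimeter_lt_top hE' (lt_top_iff_ne_top.2 hne)).ne h
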